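/- Let $n\ge 0$, let $q\in\mathbb C\setminus\{0,1\}$, and fix a value of $\ln q$; put $q^\lambda=e^{\lambda\ln q}$ for $\lambda\in\mathbb C$. Let $F(x,y_0,\dots,y_n)$ be holomorphic in a neighbourhood of $0\in\mathbb C^{n+2}$. Let $$\varphi=\sum_{k\ge1}c_kx^{\lambda_k},\qquad c_k,\lambda_k\in\mathbb C,\quad \lambda_k \text{ pairwise distinct},\quad 0<\operatorname{Re}\lambda_1\le\operatorname{Re}\lambda_2\le\dots\to+\infty,$$ be a generalized power series (some $c_k$ may vanish, so finite sums are included), and let $\sigma\varphi=\sum_k c_kq^{\lambda_k}x^{\lambda_k}$. Suppose that $\varphi$ is a formal solution of $F(x,y(x),y(qx),\dots,y(q^nx))=0$, that is, substituting $\varphi,\sigma\varphi,\dots,\sigma^n\varphi$ for $y_0,\dots,y_n$ in the Taylor series of $F$ at $0$ gives a series all of whose coefficients are zero. Suppose that there are $\nu\in\mathbb C$ and $A_0,\dots,A_n\in\mathbb C$ with $$\frac{\partial F}{\partial y_j}(x,\varphi,\sigma\varphi,\dots,\sigma^n\varphi)=A_jx^\nu+o(x^\nu),\qquad j=0,1,\dots,n,$$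 with the same $\nu$ for all $j$, where $o(x^\nu)$ stands for a series all of whose exponents have real part $>\operatorname{Re}\nu$. Let $\rho_1,\dots,\rho_\tau\in\mathbb C$ be linearly independent over $\mathbb Z$, with $\operatorname{Re}\rho_i>0$, such that every exponent of $\varphi$ with a nonzero coefficient belongs to the semigroup $\Gamma=\{m_1\rho_1+\dots+m_\tau\rho_\tau:\ m\in\mathbb Z_{\ge0}^\tau\setminus\{0\}\}$. Assume that $A_n\neq0$ and $A_0\ne0$, and that for every root $a$ of the polynomial $(z-1)L(z)$, $L(z)=A_nz^n+\dots+A_1z+A_0$, there are constants $c,\gamma>0$ such that $$\bigl|(m_1\rho_1+\dots+m_\tau\rho_\tau)\ln q-\ln a-2\pi m\mathrm i\bigr|>c\,(m_1+\dots+m_\tau)^{-\gamma}$$ for all $(m_1,\dots,m_\tau)\in\mathbb Z_{\ge0}^\tau\setminus\{0\}$ and all $m\in\mathbb Z$. Then $\varphi$ converges uniformly in every sector with vertex at $0$, of opening less than $2\pi$ and of sufficiently small radius: for every open sector $S$ with vertex $0$ and opening less than $2\pi$ and every branch of $\ln x$ on $S$ (with $x^\lambda=e^{\lambda\ln x}$)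 there is $R>0$ such that the partial sums $\sum_{k\le N}c_kx^{\lambda_k}$ converge uniformly on $S\cap\{|x|<R\}$ as $N\to\infty$. -/

import Mathlib

open Filter Topology

/-- A generalized power series `∑ₖ cₖ x^{λₖ}` with complex exponents, given by its coefficients
`cₖ` and its pairwise distinct exponents `λₖ`, where `0 < Re λ₀ ≤ Re λ₁ ≤ … → +∞`.
Coefficients may vanish, so that finite sums are included. -/
structure GenPowerSeries where
  coeff : ℕ → ℂ
  expo : ℕ → ℂ
  expo_injective : Function.Injective expo
  re_pos : ∀ k, 0 < (expo k).re
  re_mono : Monotone fun k => (expo k).re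
  re_tendsto : Tendsto (fun k => (expo k).re) atTop atTop

/-- A complex exponent, regarded as an element of the ordered additive group `ℝ × ℝ` with the
lexicographic order (real part first).  Only the additive structure matters below: the order
serves to place all generalized power series in one ring of Hahn series. -/
noncomputable def toExp (z : ℂ) : ℝ ×ₗ ℝ := toLex (z.re, z.im)

namespace GenPowerSeries

theorem coeff_eq_zero_of_notMem (φ : GenPowerSeries) {e : ℝ ×ₗ ℝ}
    (he : e ∉ Set.range fun k => toExp (φ.expo k)) :
    (∑ᶠ k, if toExp (φ.expo k) = e then φ.coeff k else 0) = 0 := by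
  have h : ∀ k, (if toExp (φ.expo k) = e then φ.coeff k else 0) = 0 := by
    intro k
    rw [if_neg]
    exact fun hk => he ⟨k, hk⟩
  simp [h]

theorem isPWO_range (φ : GenPowerSeries) : (Set.range fun k => toExp (φ.expo k)).IsPWO := by
  rw [Set.isPWO_iff_isWF, Set.isWF_iff_no_descending_seq]
  intro f hf hmem
  choose k hk using hmem
  have hle : ∀ m, (φ.expo (k m)).re ≤ (φ.expo (k 0)).re := by
    intro m
    have h1 : f m ≤ f 0 := hf.antitone (Nat.zero_le m)
    rw [← hk m, ← hk 0] at h1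
    rcases (Prod.Lex.le_iff).1 h1 with h | h
    · exact le_of_lt h
    · exact le_of_eq h.1
  have hinj : Function.Injective k := by
    intro a b hab
    apply hf.injective
    rw [← hk a, ← hk b, hab]
  obtain ⟨K, hK⟩ := (φ.re_tendsto.eventually_gt_atTop (φ.expo (k 0)).re).exists_forall_of_atTop
  have hsub : Set.range k ⊆ Set.Iio K := by
    rintro _ ⟨m, rfl⟩
    by_contra hc
    exact absurd (hK (k m) (not_lt.1 hc)) (not_lt.2 (hle m))
  exact Set.infinite_range_of_injective hinj ((Set.finite_Iio K).subset hsub)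

/-- The element of the ring of Hahn series given by a generalized power series: the coefficient at
an exponent `λₖ` is `cₖ`, and all other coefficients vanish. -/
noncomputable def toHahn (φ : GenPowerSeries) : HahnSeries (ℝ ×ₗ ℝ) ℂ where
  coeff e := ∑ᶠ k, if toExp (φ.expo k) = e then φ.coeff k else 0
  isPWO_support' := φ.isPWO_range.mono fun e he => by
    by_contra hc
    exact he (φ.coeff_eq_zero_of_notMem hc)

theorem coeff_toHahn (φ : GenPowerSeries) (k : ℕ) :
    φ.toHahn.coeff (toExp (φ.expo k)) = φ.coeff k := by
  have h : ∀ l, l ≠ k → (if toExp (φ.expo l) = toExp (φ.expo k) then φ.coeff l else 0) = 0 := by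
    intro l hl
    rw [if_neg]
    intro he
    have h1 := congrArg (fun e => (ofLex e).1) he
    have h2 := congrArg (fun e => (ofLex e).2) he
    exact hl (φ.expo_injective (Complex.ext h1 h2))
  exact (finsum_eq_single _ k h).trans (if_pos rfl)

/-- The operator `σ : ∑ cₖ x^{λₖ} ↦ ∑ cₖ q^{λₖ} x^{λₖ}`, where `q^λ = exp (λ ln q)` for the
chosen value `lnq` of `ln q`. -/
noncomputable def sigma (lnq : ℂ) (φ : GenPowerSeries) : GenPowerSeries where
  coeff k := Complex.exp (φ.expo k * lnq) * φ.coeff k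
  expo := φ.expo
  expo_injective := φ.expo_injective
  re_pos := φ.re_pos
  re_mono := φ.re_mono
  re_tendsto := φ.re_tendsto

/-- The formal value of the monomial `x^{p₀} y₀^{p₁} ⋯ yₙ^{pₙ₊₁}` at
`y₀ = φ, y₁ = σ φ, …, yₙ = σⁿ φ`. -/
noncomputable def monomialValue (lnq : ℂ) (φ : GenPowerSeries) {n : ℕ}
    (p : Fin (n + 2) →₀ ℕ) : HahnSeries (ℝ ×ₗ ℝ) ℂ :=
  HahnSeries.single (toExp 1) 1 ^ p 0 *
    ∏ j : Fin (n + 1), (((sigma lnq)^[(j : ℕ)] φ).toHahn) ^ p j.succ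

/-- The coefficient at `x^μ` of the formal series `f (x, φ, σ φ, …, σⁿ φ)`, where `f` is a power
series in `x, y₀, …, yₙ`.  By `finite_monomialValue` only finitely many terms are nonzero. -/
noncomputable def substCoeff (lnq : ℂ) (φ : GenPowerSeries) {n : ℕ}
    (f : MvPowerSeries (Fin (n + 2)) ℂ) (μ : ℂ) : ℂ :=
  ∑ᶠ p : Fin (n + 2) →₀ ℕ, MvPowerSeries.coeff p f * (monomialValue lnq φ p).coeff (toExp μ)

/-- `φ` is a formal solution of `f (x, y, σ y, …, σⁿ y) = 0`: after substitution all coefficients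
vanish. -/
def IsFormalSolution (lnq : ℂ) (φ : GenPowerSeries) {n : ℕ}
    (f : MvPowerSeries (Fin (n + 2)) ℂ) : Prop :=
  ∀ μ : ℂ, substCoeff lnq φ f μ = 0

end GenPowerSeries

/-- A formal series with coefficient function `g` has the form `A x^ν + o(x^ν)`: the coefficient at
`x^ν` is `A`, and all other terms have exponents of real part `> Re ν`. -/
def HasForm (g : ℂ → ℂ) (A ν : ℂ) : Prop :=
  g ν = A ∧ ∀ μ : ℂ, μ ≠ ν → μ.re ≤ ν.re → g μ = 0

/-- `F` is holomorphic near `0 ∈ ℂᵐ` with Taylor series `f` at `0`. -/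
def HasTaylorSeriesAtZero {m : ℕ} (F : (Fin m → ℂ) → ℂ) (f : MvPowerSeries (Fin m) ℂ) : Prop :=
  ∀ᶠ z in 𝓝 (0 : Fin m → ℂ),
    HasSum (fun p : Fin m →₀ ℕ => MvPowerSeries.coeff p f * ∏ i, z i ^ p i) (F z)

/-- The polynomial `L(z) = Aₙ zⁿ + … + A₁ z + A₀`. -/
noncomputable def charPolynomial {n : ℕ} (A : Fin (n + 1) → ℂ) : Polynomial ℂ :=
  ∑ j : Fin (n + 1), Polynomial.C (A j) * Polynomial.X ^ (j : ℕ)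

/-- The open sector with vertex `0`, radius `R`, bisecting direction `exp (i ω)` and opening
`2 h` (for `0 < h < π`). -/
def sector (ω h R : ℝ) : Set ℂ :=
  {x | x ≠ 0 ∧ ‖x‖ < R ∧ |(x * Complex.exp (-(ω * Complex.I))).arg| < h}

/-- The branch of `ln x` on a sector with bisecting direction `exp (i ω)` whose imaginary part is
`ω` on the bisector.  As `ω` runs through `ℝ`, all branches on all sectors occur. -/
noncomputable def sectorLog (ω : ℝ) (x : ℂ) : ℂ :=
  Complex.log (x * Complex.exp (-(ω * Complex.I))) + ω * Complex.I

/-- The `N`-th partial sum of `φ` at a point `x`, with `x^λ = exp (λ ln x)` for the branch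
`sectorLog ω` of the logarithm. -/
noncomputable def GenPowerSeries.partialSum (φ : GenPowerSeries) (ω : ℝ) (N : ℕ) (x : ℂ) : ℂ :=
  ∑ k ∈ Finset.range N, φ.coeff k * Complex.exp (φ.expo k * sectorLog ω x)

namespace GenPowerSeries

/-- All exponents of the Hahn series `g` have first component (real part) at least `a`. -/
def ReGe (a : ℝ) (g : HahnSeries (ℝ ×ₗ ℝ) ℂ) : Prop :=
  ∀ e, g.coeff e ≠ 0 → a ≤ (ofLex e).1

theorem ReGe.mul {a b : ℝ} {g h : HahnSeries (ℝ ×ₗ ℝ) ℂ} (hg : ReGe a g) (hh : ReGe b h) :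
    ReGe (a + b) (g * h) := by
  intro e he
  have hm : e ∈ (g * h).support := he
  obtain ⟨u, hu, v, hv, rfl⟩ := Set.mem_add.1 (HahnSeries.support_mul_subset hm)
  exact add_le_add (hg u hu) (hh v hv)

theorem reGe_one : ReGe 0 (1 : HahnSeries (ℝ ×ₗ ℝ) ℂ) := by
  intro e he
  by_cases h : e = 0
  · subst h; exact le_refl _
  · exact absurd (by simp [HahnSeries.coeff_one, h]) he

theorem ReGe.pow {a : ℝ} {g : HahnSeries (ℝ ×ₗ ℝ) ℂ} (hg : ReGe a g) (k : ℕ) :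
    ReGe (k * a) (g ^ k) := by
  induction k with
  | zero => simpa using reGe_one
  | succ k ih =>
    rw [pow_succ]
    have h := ih.mul hg
    have h2 : (k : ℝ) * a + a = ((k + 1 : ℕ) : ℝ) * a := by push_cast; ring
    rwa [h2] at h

theorem ReGe.prod {ι : Type*} (s : Finset ι) (a : ι → ℝ) (g : ι → HahnSeries (ℝ ×ₗ ℝ) ℂ)
    (h : ∀ i ∈ s, ReGe (a i) (g i)) : ReGe (∑ i ∈ s, a i) (∏ i ∈ s, g i) := by
  classical
  induction s using Finset.induction_on with
  | empty => simpa using reGe_one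
  | insert i s hi ih =>
    rw [Finset.sum_insert hi, Finset.prod_insert hi]
    exact (h i (Finset.mem_insert_self _ _)).mul
      (ih fun j hj => h j (Finset.mem_insert_of_mem hj))

theorem sigma_iterate_expo (lnq : ℂ) (φ : GenPowerSeries) (j : ℕ) :
    ((sigma lnq)^[j] φ).expo = φ.expo := by
  induction j with
  | zero => rfl
  | succ j ih => rw [Function.iterate_succ_apply']; exact ih

theorem reGe_toHahn (φ : GenPowerSeries) : ReGe (φ.expo 0).re φ.toHahn := by
  intro e he
  by_cases hmem : e ∈ Set.range fun k => toExp (φ.expo k)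
  · obtain ⟨k, rfl⟩ := hmem
    exact φ.re_mono (Nat.zero_le k)
  · exact absurd (φ.coeff_eq_zero_of_notMem hmem) he

/-- The sum that defines `substCoeff` has only finitely many nonzero terms, so that substitution of
a generalized power series is well defined. -/
theorem finite_monomialValue (lnq : ℂ) (φ : GenPowerSeries) {n : ℕ} (e : ℝ ×ₗ ℝ) :
    {p : Fin (n + 2) →₀ ℕ | (monomialValue lnq φ p).coeff e ≠ 0}.Finite := by
  set m : ℝ := min 1 (φ.expo 0).re with hm
  have hmpos : 0 < m := lt_min one_pos (φ.re_pos 0)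
  have hx : ReGe m (HahnSeries.single (toExp 1) (1 : ℂ)) := by
    intro e' he'
    by_cases h : e' = toExp 1
    · subst h
      exact min_le_left 1 (φ.expo 0).re
    · exact absurd (HahnSeries.coeff_single_of_ne h) he'
  have hy : ∀ j : ℕ, ReGe m (((sigma lnq)^[j] φ).toHahn) := by
    intro j e' he'
    have h := reGe_toHahn ((sigma lnq)^[j] φ) e' he'
    rw [sigma_iterate_expo] at h
    exact (min_le_right _ _).trans h
  have hkey : ∀ p : Fin (n + 2) →₀ ℕ,
      ReGe ((∑ i, (p i : ℝ)) * m) (monomialValue lnq φ p) := by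
    intro p
    have h := (hx.pow (p 0)).mul
      (ReGe.prod Finset.univ (fun j : Fin (n + 1) => (p j.succ : ℝ) * m) _
        fun j _ => (hy j).pow (p j.succ))
    have h2 : (∑ i, (p i : ℝ)) * m
        = (p 0 : ℝ) * m + ∑ j : Fin (n + 1), (p j.succ : ℝ) * m := by
      rw [Fin.sum_univ_succ, add_mul, Finset.sum_mul]
    rw [h2]
    exact h
  obtain ⟨K, hK⟩ := exists_nat_ge ((ofLex e).1 / m)
  have hbig : {p : Fin (n + 2) →₀ ℕ | ∀ i, p i ≤ K}.Finite := by
    have hfin : {g : Fin (n + 2) → ℕ | ∀ i, g i ∈ Set.Iic K}.Finite :=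
      Set.Finite.pi' fun _ => Set.finite_Iic K
    refine Set.Finite.of_finite_image (f := fun p : Fin (n + 2) →₀ ℕ => (p : Fin (n + 2) → ℕ))
      (hfin.subset ?_) DFunLike.coe_injective.injOn
    rintro _ ⟨p, hp, rfl⟩ i
    exact hp i
  refine hbig.subset fun p hp i => ?_
  have h1 := hkey p e hp
  rw [← le_div_iff₀ hmpos] at h1
  have h2 : (p i : ℝ) ≤ ∑ i, (p i : ℝ) :=
    Finset.single_le_sum (f := fun i => (p i : ℝ)) (fun _ _ => Nat.cast_nonneg _)
      (Finset.mem_univ i)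
  exact_mod_cast h2.trans (h1.trans hK)

end GenPowerSeries

/-! The argument reduces the several-generator problem to a one-variable one. The Diophantine
condition at the roots of `L` gives `L(q^λ) ≠ 0` for all `λ ∈ Γ`. Suppose some exponent of `φ` is
irrational. Choose a `ℚ`-linear `χ : ℂ → ℚ` with `χ(1) = 0` that does not vanish on it, and apply
the derivation `x^e ↦ χ(e) x^e` to `F(x, φ, …, σⁿφ) = 0`. The derivation kills `x`, so the chain
rule yields a solution of the linearized equation. If `λ` is a first exponent of `φ` with `χ(λ) ≠
0`, the coefficient at `x^(ν+λ)` reads `L(q^λ) χ(λ) c_λ = 0`, a contradiction. Hence every exponent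
is rational (`exists_rat_expo`).

Rational elements of a semigroup with independent generators have proportional coordinates, so the
exponents of `φ` have a common denominator `s` (`exists_common_denominator`). With `t = x^(1/s)` and
`Q = exp(ln q / s)`, `φ` becomes an ordinary power series `ψ(t) = ∑ a_j t^j`.

Comparing coefficients at `t^(ν+j)`, where `ν` now counts powers of `t`, expresses `L(Q^j) a_j` for
`j > ν` through earlier coefficients (`coeff_aeval_trunc_eq`). The difficulty is the division by
`L(Q^j)`, whose reciprocals are only polynomially bounded and could accumulate along the recursion.
If `Q^i` and `Q^j` are both close to one root, then `Q^(j-i)` is close to `1`. The condition at the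
extra root `1` forbids this unless `j - i` is large. Siegel's argument (`chainValue_le`,
`SiegelBounded.of_min_le`) turns this into a polynomially bounded weight that absorbs each division
at the price of a power of an index gap, and such weights can be multiplied over the roots of `L`.

The coefficients are then majorized by the weight times `j^(-2γ) j^(-2) C^(j-ν-1)`
(`smallDivisor_mul_coeff_pow_le`, `exists_norm_coeff_le_pow`). The factor `j^(-2γ)` pays for gaps,
`j^(-2)` makes convolutions cheap, and the exponent of `C` gains at least one at every step, which
pays for all geometric losses. Geometric bounds on `a_j` give convergence in `t`, hence in sectors
in `x`. -/

/-! ### Siegel's lemma on products along decreasing chains. -/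

/-- The product of the values `e k` along a chain of indices, each gap `g` between consecutive
indices being penalized by `(B g ^ γ)⁻¹`. -/
noncomputable def chainValue (e : ℕ → ℝ) (B : ℝ) (γ : ℕ) : List ℕ → ℝ
  | [] => 1
  | [x] => e x
  | x :: y :: t => e x / (B * ((x : ℝ) - y) ^ γ) * chainValue e B γ (y :: t)

section Chain

variable {e : ℕ → ℝ} {B N : ℝ} {γ : ℕ}

theorem chainValue_nonneg (he : ∀ j, 0 ≤ e j) (hB : 0 ≤ B) :
    ∀ l : List ℕ, l.Pairwise (· > ·) → 0 ≤ chainValue e B γ l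
  | [], _ => zero_le_one
  | [x], _ => he x
  | x :: y :: t, hl => by
    rw [chainValue]
    have h1 : (y : ℝ) < x := by exact_mod_cast List.rel_of_pairwise_cons hl (by simp)
    exact mul_nonneg (div_nonneg (he x) (mul_nonneg hB (pow_nonneg (by linarith) _)))
      (chainValue_nonneg he hB _ hl.of_cons)

/-- Prepending an index preserves inequalities between chains with the same first element. -/
theorem chainValue_cons_le (he : ∀ j, 0 ≤ e j) (hB : 0 ≤ B) {w u : ℕ} {s t : List ℕ}
    (hwu : u < w) (h : chainValue e B γ (u :: s) ≤ chainValue e B γ (u :: t)) :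
    chainValue e B γ (w :: u :: s) ≤ chainValue e B γ (w :: u :: t) := by
  have h1 : (u : ℝ) < w := by exact_mod_cast hwu
  rw [chainValue, chainValue]
  exact mul_le_mul_of_nonneg_left h
    (div_nonneg (he w) (mul_nonneg hB (pow_nonneg (by linarith) _)))

theorem chainValue_prefix_le (he : ∀ j, 0 ≤ e j) (hB : 0 ≤ B) {u : ℕ} {s t : List ℕ}
    (h : chainValue e B γ (u :: s) ≤ chainValue e B γ (u :: t)) :
    ∀ a : List ℕ, (a ++ u :: s).Pairwise (· > ·) →
      chainValue e B γ (a ++ u :: s) ≤ chainValue e B γ (a ++ u :: t)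
  | [], _ => h
  | [w], hl => chainValue_cons_le he hB (List.rel_of_pairwise_cons hl (by simp)) h
  | w :: v :: a, hl => by
    have h1 := chainValue_prefix_le he hB h (v :: a) hl.of_cons
    exact chainValue_cons_le he hB (List.rel_of_pairwise_cons hl (by simp)) h1

/-- If no two values of `e` at distinct indices are both large compared with a power of their
distance, then an element of a chain at which `e` is minimal can be removed without decreasing
the penalized product. -/
theorem chainValue_erase_min (he : ∀ j, 0 ≤ e j) (hN : 1 ≤ N)
    (hmin : ∀ i j, 1 ≤ i → i < j → min (e i) (e j) ≤ N * ((j : ℝ) - i) ^ γ)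
    {a b : List ℕ} {x : ℕ} (hl : (a ++ x :: b).Pairwise (· > ·))
    (hpos : ∀ k ∈ a ++ x :: b, 1 ≤ k) (hx : ∀ k ∈ a ++ x :: b, e x ≤ e k)
    (hab : a ++ b ≠ []) :
    chainValue e (N * 2 ^ γ) γ (a ++ x :: b) ≤ chainValue e (N * 2 ^ γ) γ (a ++ b) := by
  have hB : 0 ≤ N * 2 ^ γ := by positivity
  have hB' : N ≤ N * 2 ^ γ := le_mul_of_one_le_right (by linarith) (one_le_pow₀ (by norm_num))
  have hxpos : 1 ≤ x := hpos x (by simp)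
  have hsucc : ∀ v ∈ b, v < x ∧ e x ≤ N * ((x : ℝ) - v) ^ γ := by
    intro v hv
    have h1 : v < x := by
      have := (List.pairwise_append.1 hl).2.1
      exact List.rel_of_pairwise_cons this hv
    have h2 := hmin v x (hpos v (by simp [hv])) h1
    rw [min_eq_right (hx v (by simp [hv]))] at h2
    exact ⟨h1, h2⟩
  have hpred : ∀ u ∈ a, x < u ∧ e x ≤ N * ((u : ℝ) - x) ^ γ := by
    intro u hu
    have h1 : x < u := (List.pairwise_append.1 hl).2.2 u hu x (by simp)
    have h2 := hmin x u hxpos h1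
    rw [min_eq_left (hx u (by simp [hu]))] at h2
    exact ⟨h1, h2⟩
  have hfrac : ∀ d : ℝ, 0 < d → e x ≤ N * d ^ γ → e x / (N * 2 ^ γ * d ^ γ) ≤ 1 := by
    intro d hd h
    have : 0 < N * 2 ^ γ * d ^ γ := by positivity
    rw [div_le_one this]
    exact h.trans (mul_le_mul_of_nonneg_right hB' (by positivity))
  rcases List.eq_nil_or_concat' a with rfl | ⟨a, u, rfl⟩
  · cases b with
    | nil => exact absurd rfl hab
    | cons v b =>
      obtain ⟨h1, h2⟩ := hsucc v (by simp)
      have h1' : (v : ℝ) < x := by exact_mod_cast h1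
      simp only [List.nil_append] at hl ⊢
      rw [chainValue]
      exact mul_le_of_le_one_left (chainValue_nonneg he hB _ hl.of_cons)
        (hfrac _ (by linarith) h2)
  · obtain ⟨h3, h4⟩ := hpred u (by simp)
    have h3' : (x : ℝ) < u := by exact_mod_cast h3
    have hfu : e x / (N * 2 ^ γ * ((u : ℝ) - x) ^ γ) ≤ 1 := hfrac _ (by linarith) h4
    simp only [List.append_assoc, List.singleton_append] at hl ⊢
    refine chainValue_prefix_le he hB ?_ a hl
    cases b with
    | nil =>
      rw [chainValue, chainValue, chainValue, div_mul_eq_mul_div, mul_div_assoc]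
      exact mul_le_of_le_one_right (he u) hfu
    | cons v b =>
      obtain ⟨h1, h2⟩ := hsucc v (by simp)
      have h1' : (v : ℝ) < x := by exact_mod_cast h1
      have hl2 : (v :: b).Pairwise (· > ·) :=
        ((List.pairwise_append.1 hl).2.1).of_cons.of_cons
      rw [chainValue, chainValue, chainValue, ← mul_assoc]
      refine mul_le_mul_of_nonneg_right ?_ (chainValue_nonneg he hB _ hl2)
      set p : ℝ := (u : ℝ) - x with hp
      set r : ℝ := (x : ℝ) - v with hr
      have hp0 : 0 < p := by rw [hp]; linarith
      have hr0 : 0 < r := by rw [hr]; linarith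
      have hpr : (u : ℝ) - v = p + r := by rw [hp, hr]; ring
      rw [hpr, div_mul_div_comm, div_le_div_iff₀ (by positivity) (by positivity)]
      -- Merging the gaps `p` and `r`: `e x` is at most `N` times the `γ`-th power of the smaller
      -- gap, and `p + r` is at most twice the larger one. This is the origin of the penalty
      -- constant `N * 2 ^ γ`.
      have key : e x * (p + r) ^ γ ≤ (N * 2 ^ γ) * (p ^ γ * r ^ γ) := by
        rcases le_total p r with h | h
        · calc e x * (p + r) ^ γ ≤ (N * p ^ γ) * (2 * r) ^ γ := by
                gcongr
                linarith
            _ = _ := by rw [mul_pow]; ring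
        · calc e x * (p + r) ^ γ ≤ (N * r ^ γ) * (2 * p) ^ γ := by
                gcongr
                linarith
            _ = _ := by rw [mul_pow]; ring
      have h5 : 0 ≤ e u * (N * 2 ^ γ) := mul_nonneg (he u) hB
      calc e u * e x * (N * 2 ^ γ * (p + r) ^ γ)
          = e u * (N * 2 ^ γ) * (e x * (p + r) ^ γ) := by ring
        _ ≤ e u * (N * 2 ^ γ) * ((N * 2 ^ γ) * (p ^ γ * r ^ γ)) :=
            mul_le_mul_of_nonneg_left key h5
        _ = _ := by ring

/-- Siegel's lemma on products of small divisors along a chain. -/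
theorem chainValue_le (he : ∀ j, 0 ≤ e j) (hN : 1 ≤ N)
    (hpow : ∀ j, 1 ≤ j → e j ≤ N * (j : ℝ) ^ γ)
    (hmin : ∀ i j, 1 ≤ i → i < j → min (e i) (e j) ≤ N * ((j : ℝ) - i) ^ γ) (m : ℕ) :
    ∀ (n : ℕ) (l : List ℕ), l.length = n + 1 → l.Pairwise (· > ·) → (∀ k ∈ l, 1 ≤ k ∧ k ≤ m) →
      chainValue e (N * 2 ^ γ) γ l ≤ N * (m : ℝ) ^ γ := by
  intro n
  induction n with
  | zero =>
    intro l hl _ hk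
    obtain ⟨x, rfl⟩ := List.length_eq_one_iff.1 hl
    obtain ⟨h1, h2⟩ := hk x (by simp)
    rw [chainValue]
    refine (hpow x h1).trans ?_
    gcongr
  | succ n ih =>
    intro l hlen hl hk
    have hne : l.toFinset.Nonempty := by
      rw [List.toFinset_nonempty_iff]
      rintro rfl
      simp at hlen
    -- Deleting a minimal element repeatedly leaves a single index, where the polynomial bound
    -- applies.
    obtain ⟨x, hxl, hx⟩ := l.toFinset.exists_min_image e hne
    obtain ⟨a, b, rfl⟩ := List.append_of_mem (List.mem_toFinset.1 hxl)
    have hlen' : (a ++ b).length = n + 1 := by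
      simp only [List.length_append, List.length_cons] at hlen ⊢
      omega
    have hsub : (a ++ b).Sublist (a ++ x :: b) := by simp
    refine (chainValue_erase_min he hN hmin hl (fun k hk' => (hk k hk').1)
      (fun k hk' => hx k (List.mem_toFinset.2 hk')) ?_).trans
      (ih _ hlen' (hl.sublist hsub) fun k hk' => hk k (hsub.subset hk'))
    intro h
    rw [h] at hlen'
    simp at hlen'

end Chain

/-! ### Siegel weights. -/

/-- `D` is dominated by a weight that grows polynomially and that absorbs multiplication by `D`
at the price of a power of the gap between the indices. -/
def SiegelBounded (D : ℕ → ℝ) : Prop :=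
  ∃ (Λ : ℕ → ℝ) (N : ℝ) (γ : ℕ), 1 ≤ N ∧
    (∀ j, 1 ≤ j → 0 ≤ D j ∧ D j ≤ Λ j ∧ Λ j ≤ N * (j : ℝ) ^ γ) ∧
    ∀ i j, 1 ≤ i → i < j → D j * Λ i ≤ N * ((j : ℝ) - i) ^ γ * Λ j

namespace SiegelBounded

/-- Siegel's theorem: small divisors that are bounded polynomially, and no two of which are small
simultaneously unless their indices are far apart, are dominated by a Siegel weight. -/
theorem of_min_le {e : ℕ → ℝ} {N : ℝ} {γ : ℕ} (he : ∀ j, 0 ≤ e j) (hN : 1 ≤ N)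
    (hpow : ∀ j, 1 ≤ j → e j ≤ N * (j : ℝ) ^ γ)
    (hmin : ∀ i j, 1 ≤ i → i < j → min (e i) (e j) ≤ N * ((j : ℝ) - i) ^ γ) :
    SiegelBounded e := by
  set B : ℝ := N * 2 ^ γ with hBdef
  have hNB : N ≤ B := le_mul_of_one_le_right (by linarith) (one_le_pow₀ (by norm_num))
  have hB1 : 1 ≤ B := hN.trans hNB
  let chains : ℕ → Set (List ℕ) := fun j =>
    {t | (j :: t).Pairwise (· > ·) ∧ ∀ k ∈ j :: t, 1 ≤ k}
  have hle : ∀ j, ∀ t ∈ chains j, chainValue e B γ (j :: t) ≤ N * (j : ℝ) ^ γ := by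
    intro j t ht
    refine chainValue_le he hN hpow hmin j t.length (j :: t) (by simp) ht.1 ?_
    intro k hk
    refine ⟨ht.2 k hk, ?_⟩
    rcases List.mem_cons.1 hk with rfl | h
    · exact le_rfl
    · exact le_of_lt (List.rel_of_pairwise_cons ht.1 h)
  -- The supremum over all chains starting at `j` is finite by Siegel's lemma. Prepending `j` to a
  -- chain that starts at `i` gives the absorption inequality.
  let Λ : ℕ → ℝ := fun j => sSup ((fun t => chainValue e B γ (j :: t)) '' chains j)
  have hbdd : ∀ j, BddAbove ((fun t => chainValue e B γ (j :: t)) '' chains j) := by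
    intro j
    refine ⟨N * (j : ℝ) ^ γ, ?_⟩
    rintro _ ⟨t, ht, rfl⟩
    exact hle j t ht
  have hnil : ∀ j, 1 ≤ j → [] ∈ chains j := fun j hj => ⟨by simp, by simpa using hj⟩
  refine ⟨Λ, B, γ, hB1, ?_, ?_⟩
  · intro j hj
    refine ⟨he j, le_csSup (hbdd j) ⟨[], hnil j hj, rfl⟩, ?_⟩
    refine csSup_le ⟨_, [], hnil j hj, rfl⟩ ?_
    rintro _ ⟨t, ht, rfl⟩
    exact (hle j t ht).trans (by gcongr)
  · intro i j hi hij
    have hij' : (i : ℝ) < j := by exact_mod_cast hij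
    have hd : 0 < B * ((j : ℝ) - i) ^ γ := by
      have : 0 < (j : ℝ) - i := by linarith
      positivity
    have hsup : ∀ t ∈ chains i, e j * chainValue e B γ (i :: t) ≤
        B * ((j : ℝ) - i) ^ γ * Λ j := by
      intro t ht
      have h1 : chainValue e B γ (j :: i :: t) ≤ Λ j := by
        refine le_csSup (hbdd j) ⟨i :: t, ⟨?_, ?_⟩, rfl⟩
        · refine List.pairwise_cons.2 ⟨?_, ht.1⟩
          intro k hk
          rcases List.mem_cons.1 hk with rfl | h
          · exact hij
          · exact (List.rel_of_pairwise_cons ht.1 h).trans hij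
        · intro k hk
          rcases List.mem_cons.1 hk with rfl | h
          · omega
          · exact ht.2 k h
      rw [chainValue, div_mul_eq_mul_div, div_le_iff₀' hd] at h1
      exact h1
    have hj : 1 ≤ j := by omega
    rcases (he j).eq_or_lt with h0 | h0
    · rw [← h0, zero_mul]
      exact mul_nonneg hd.le ((he j).trans (le_csSup (hbdd j) ⟨[], hnil j hj, rfl⟩))
    · rw [← le_div_iff₀' h0]
      refine csSup_le ⟨_, [], hnil i hi, rfl⟩ ?_
      rintro _ ⟨t, ht, rfl⟩
      rw [le_div_iff₀' h0]
      exact hsup t ht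

theorem const {c : ℝ} (hc : 0 ≤ c) : SiegelBounded fun _ => c := by
  refine ⟨fun _ => max c 1, max c 1, 0, le_max_right _ _, fun j _ => ⟨hc, le_max_left _ _, ?_⟩, ?_⟩
  · simp
  · intro i j _ _
    rw [pow_zero, mul_one]
    exact mul_le_mul_of_nonneg_right (le_max_left _ _) (hc.trans (le_max_left _ _))

/-- The bound on pairwise minima is not inherited by products, since one factor may be large at `i`
and the other at a nearby `j`. The existence of a weight is inherited, which is the reason for
working with weights. -/
theorem mul {D E : ℕ → ℝ} (hD : SiegelBounded D) (hE : SiegelBounded E) :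
    SiegelBounded fun j => D j * E j := by
  obtain ⟨Λ, N, γ, hN, h1, h2⟩ := hD
  obtain ⟨Λ', N', γ', hN', h1', h2'⟩ := hE
  have hΛ : ∀ j, 1 ≤ j → 0 ≤ Λ j := fun j hj => (h1 j hj).1.trans (h1 j hj).2.1
  have hΛ' : ∀ j, 1 ≤ j → 0 ≤ Λ' j := fun j hj => (h1' j hj).1.trans (h1' j hj).2.1
  refine ⟨fun j => Λ j * Λ' j, N * N', γ + γ', by nlinarith, fun j hj => ⟨?_, ?_, ?_⟩, ?_⟩
  · exact mul_nonneg (h1 j hj).1 (h1' j hj).1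
  · exact mul_le_mul (h1 j hj).2.1 (h1' j hj).2.1 (h1' j hj).1 (hΛ j hj)
  · calc Λ j * Λ' j ≤ (N * (j : ℝ) ^ γ) * (N' * (j : ℝ) ^ γ') :=
          mul_le_mul (h1 j hj).2.2 (h1' j hj).2.2 (hΛ' j hj) (by positivity)
      _ = _ := by rw [pow_add]; ring
  · intro i j hi hij
    have hj : 1 ≤ j := by omega
    have hij' : (0 : ℝ) < j - i := sub_pos.2 (by exact_mod_cast hij)
    calc D j * E j * (Λ i * Λ' i) = (D j * Λ i) * (E j * Λ' i) := by ring
      _ ≤ (N * ((j : ℝ) - i) ^ γ * Λ j) * (N' * ((j : ℝ) - i) ^ γ' * Λ' j) :=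
          mul_le_mul (h2 i j hi hij) (h2' i j hi hij) (mul_nonneg (h1' j hj).1 (hΛ' i hi))
            (mul_nonneg (by positivity) (hΛ j hj))
      _ = _ := by rw [pow_add]; ring

theorem multiset_prod {ι : Type*} (s : Multiset ι) (D : ι → ℕ → ℝ)
    (h : ∀ a ∈ s, SiegelBounded (D a)) : SiegelBounded fun j => (s.map fun a => D a j).prod := by
  induction s using Multiset.induction_on with
  | empty => simpa using const zero_le_one
  | cons a s ih =>
    simp only [Multiset.map_cons, Multiset.prod_cons]
    exact (h a (by simp)).mul (ih fun b hb => h b (by simp [hb]))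

end SiegelBounded

/-! ### Small divisors of the characteristic polynomial. -/

/-- The numbers `j ℓ`, `j ∈ S`, stay away from the logarithms of `a`, up to a power of `j`. -/
def LogDiophantine (S : Set ℕ) (l a : ℂ) : Prop :=
  ∃ (c : ℝ) (g : ℕ), 0 < c ∧ ∀ j ∈ S, 1 ≤ j → ∀ k : ℤ,
    c / (j : ℝ) ^ g < ‖j * l - Complex.log a - 2 * Real.pi * k * Complex.I‖

/-- The reciprocal of the relative distance from `exp (j ℓ)` to `a`, for `j ∈ S`. -/
noncomputable def smallDivisor (S : Set ℕ) (l a : ℂ) (j : ℕ) : ℝ :=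
  open Classical in
  if j ∈ S then max 1 ‖Complex.exp (j * l)‖ / ‖Complex.exp (j * l) - a‖ else 1

theorem smallDivisor_nonneg (S : Set ℕ) (l a : ℂ) (j : ℕ) : 0 ≤ smallDivisor S l a j := by
  unfold smallDivisor
  split_ifs
  · positivity
  · exact zero_le_one

/-- With `w = exp z / a`, either `w` is within `1/2` of `1`, where the logarithm is Lipschitz and
the distance of `z` to the logarithms of `a` controls `|w - 1|`, or `exp z` is at distance at least
`|a|/2` from `a`. -/
theorem le_norm_exp_sub {a : ℂ} (ha : a ≠ 0) :
    ∃ κ : ℝ, 0 < κ ∧ ∀ (z : ℂ) (δ : ℝ), δ ≤ 1 →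
      (∀ k : ℤ, δ < ‖z - Complex.log a - 2 * Real.pi * k * Complex.I‖) →
      κ * δ * max 1 ‖Complex.exp z‖ ≤ ‖Complex.exp z - a‖ := by
  have hA : 0 < ‖a‖ := norm_pos_iff.2 ha
  refine ⟨‖a‖ / (6 * (1 + ‖a‖)), by positivity, ?_⟩
  intro z δ hδ h
  set A := ‖a‖ with hAdef
  set κ := A / (6 * (1 + A)) with hκ
  have hκ0 : 0 < κ := by positivity
  have hκA : κ * (1 + A) = A / 6 := by rw [hκ]; field_simp
  have hw : Complex.exp (z - Complex.log a) = Complex.exp z / a := by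
    rw [Complex.exp_sub, Complex.exp_log ha]
  set w := Complex.exp z / a with hwdef
  have hX : ‖Complex.exp z - a‖ = A * ‖w - 1‖ := by
    rw [hAdef, ← norm_mul]
    congr 1
    rw [hwdef]
    field_simp
  have hE : ‖Complex.exp z‖ ≤ ‖Complex.exp z - a‖ + A := by
    simpa using norm_add_le (Complex.exp z - a) a
  rcases lt_or_ge δ 0 with hneg | hpos
  · refine le_trans ?_ (norm_nonneg _)
    exact mul_nonpos_of_nonpos_of_nonneg (mul_nonpos_of_nonneg_of_nonpos hκ0.le hneg.le)
      (by positivity)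
  set m := max 1 ‖Complex.exp z‖ with hm
  have hm1 : 1 ≤ m := le_max_left _ _
  have hmle : m ≤ 1 + ‖Complex.exp z‖ := max_le (by linarith [norm_nonneg (Complex.exp z)])
    (by linarith)
  rcases le_or_gt ‖w - 1‖ (1 / 2) with hsmall | hlarge
  · have h1 : ‖Complex.log w‖ ≤ 3 / 2 * ‖w - 1‖ := by
      simpa using Complex.norm_log_one_add_half_le_self hsmall
    have hw0 : w ≠ 0 := div_ne_zero (Complex.exp_ne_zero z) ha
    obtain ⟨k, hk⟩ : ∃ k : ℤ, z - Complex.log a = Complex.log w + k * (2 * Real.pi * Complex.I) := by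
      apply Complex.exp_eq_exp_iff_exists_int.1
      rw [hw, Complex.exp_log hw0]
    have h2 := h k
    have h3 : z - Complex.log a - 2 * Real.pi * k * Complex.I = Complex.log w := by
      rw [hk]; ring
    rw [h3] at h2
    have h4 : m ≤ 1 + 3 / 2 * A := by
      rw [hX] at hE
      nlinarith
    rw [hX]
    have h5 : κ * m ≤ A / 4 := by nlinarith
    nlinarith [norm_nonneg (w - 1)]
  · have h1 : A / 2 ≤ ‖Complex.exp z - a‖ := by rw [hX]; nlinarith
    have h2 : κ ≤ 1 / 6 := by nlinarith
    have h3 : κ * m ≤ ‖Complex.exp z - a‖ := by nlinarith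
    refine le_trans ?_ h3
    have := mul_nonneg hκ0.le (zero_le_one.trans hm1)
    nlinarith

/-- If `u` and `u v` were both very close to `a`, then `u (v - 1)` would be small while `|u| ≥
|a|/2`, forcing `v` closer to `1` than `η`. -/
theorem min_div_norm_sub_le {a u v : ℂ} (ha : a ≠ 0) {x η : ℝ} (hη : 0 < η)
    (huv : η ≤ ‖v - 1‖) (hx1 : 4 * (1 + ‖a‖) / ‖a‖ + 4 ≤ x)
    (hx2 : 4 * (1 + 2 * ‖a‖) / (‖a‖ * η) ≤ x) :
    min (max 1 ‖u‖ / ‖u - a‖) (max 1 ‖u * v‖ / ‖u * v - a‖) ≤ x := by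
  have hA : 0 < ‖a‖ := norm_pos_iff.2 ha
  set A := ‖a‖ with hAdef
  by_contra! hlt
  rw [lt_min_iff] at hlt
  have hx0 : 0 < x := lt_of_lt_of_le (by positivity) hx1
  have hx4 : 4 ≤ x := le_trans (by linarith [show 0 < 4 * (1 + A) / A by positivity]) hx1
  have hxA : 4 * (1 + A) ≤ x * A := by
    rw [← div_le_iff₀ hA]
    linarith
  rw [div_le_iff₀ (by positivity)] at hx2
  have key : ∀ w : ℂ, x < max 1 ‖w‖ / ‖w - a‖ → x * ‖w - a‖ < 1 + 2 * A ∧ A / 2 ≤ ‖w‖ := by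
    intro w hw
    have h0 : 0 < ‖w - a‖ := by
      rcases (norm_nonneg (w - a)).eq_or_lt with h | h
      · rw [← h, div_zero] at hw
        linarith
      · exact h
    rw [lt_div_iff₀ h0] at hw
    have h1 : ‖w‖ ≤ ‖w - a‖ + A := by simpa using norm_add_le (w - a) a
    have h2 : A ≤ ‖w - a‖ + ‖w‖ := by
      have := norm_sub_le w (w - a)
      rw [sub_sub_cancel] at this
      linarith
    have h3 : max 1 ‖w‖ ≤ 1 + 2 * A := by
      refine max_le (by linarith) ?_
      by_contra! hc
      rw [max_eq_right (by linarith)] at hw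
      nlinarith
    refine ⟨by linarith, ?_⟩
    by_contra! hc
    nlinarith
  obtain ⟨h1, h2⟩ := key u hlt.1
  obtain ⟨h3, -⟩ := key (u * v) hlt.2
  have h4 : ‖u‖ * ‖v - 1‖ ≤ ‖u * v - a‖ + ‖u - a‖ := by
    rw [← norm_mul]
    calc ‖u * (v - 1)‖ = ‖(u * v - a) - (u - a)‖ := by congr 1; ring
      _ ≤ _ := norm_sub_le _ _
  have h5 : A / 2 * η ≤ ‖u‖ * ‖v - 1‖ := mul_le_mul h2 huv hη.le (norm_nonneg _)
  nlinarith

theorem SiegelBounded.smallDivisor {S : Set ℕ} {l a : ℂ} (ha : a ≠ 0)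
    (hS : ∀ i ∈ S, ∀ j ∈ S, i < j → j - i ∈ S)
    (h : LogDiophantine S l a) (h1 : LogDiophantine S l 1) :
    SiegelBounded (smallDivisor S l a) := by
  have hlow : ∀ b : ℂ, b ≠ 0 → LogDiophantine S l b → ∃ (c : ℝ) (g : ℕ), 0 < c ∧
      ∀ j ∈ S, 1 ≤ j → c / (j : ℝ) ^ g * max 1 ‖Complex.exp (j * l)‖ ≤
        ‖Complex.exp (j * l) - b‖ := by
    rintro b hb ⟨c, g, hc, hj⟩
    obtain ⟨κ, hκ, hz⟩ := le_norm_exp_sub hb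
    refine ⟨κ * min c 1, g, by positivity, fun j hjS hj1 => ?_⟩
    have hpow : (1 : ℝ) ≤ (j : ℝ) ^ g := one_le_pow₀ (by exact_mod_cast hj1)
    have := hz (j * l) (min c 1 / (j : ℝ) ^ g) ?_ fun k => lt_of_le_of_lt ?_ (hj j hjS hj1 k)
    · rwa [← mul_div_assoc] at this
    · exact (div_le_one (by linarith)).2 ((min_le_right _ _).trans hpow)
    · gcongr
      exact min_le_left _ _
  obtain ⟨c, g, hc, hcj⟩ := hlow a ha h
  obtain ⟨c', g', hc', hcj'⟩ := hlow 1 one_ne_zero h1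
  have hA : 0 < ‖a‖ := norm_pos_iff.2 ha
  -- The first summand serves the polynomial bound, the other two meet the thresholds of
  -- `min_div_norm_sub_le`.
  set N : ℝ := 1 / c + (4 * (1 + ‖a‖) / ‖a‖ + 4) + 4 * (1 + 2 * ‖a‖) / (‖a‖ * c') with hN
  have t1 : 0 < 1 / c := by positivity
  have t2 : 0 < 4 * (1 + ‖a‖) / ‖a‖ := by positivity
  have t3 : 0 < 4 * (1 + 2 * ‖a‖) / (‖a‖ * c') := by positivity
  have hN1 : 1 ≤ N := by linarith
  have hone : ∀ (d : ℝ) (p : ℕ), 1 ≤ d → 1 ≤ N * d ^ p := fun d p hd => by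
    have := one_le_pow₀ hd (n := p)
    nlinarith
  refine SiegelBounded.of_min_le (N := N) (γ := g + g') (smallDivisor_nonneg S l a) hN1 ?_ ?_
  · intro j hj
    have hj' : (1 : ℝ) ≤ j := by exact_mod_cast hj
    unfold _root_.smallDivisor
    split_ifs with hjS
    · have h2 := hcj j hjS hj
      have hm : (1 : ℝ) ≤ max 1 ‖Complex.exp (j * l)‖ := le_max_left _ _
      have hd : 0 < c / (j : ℝ) ^ g := by positivity
      rw [div_le_iff₀ (lt_of_lt_of_le (by positivity) h2)]
      have h3 : (j : ℝ) ^ g ≤ (j : ℝ) ^ (g + g') := pow_le_pow_right₀ hj' (by omega)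
      calc max 1 ‖Complex.exp (j * l)‖
          = (1 / c * (j : ℝ) ^ g) * (c / (j : ℝ) ^ g * max 1 ‖Complex.exp (j * l)‖) := by
            field_simp
        _ ≤ (N * (j : ℝ) ^ (g + g')) * (c / (j : ℝ) ^ g * max 1 ‖Complex.exp (j * l)‖) := by
            gcongr
            linarith
        _ ≤ _ := by gcongr
    · exact hone _ _ hj'
  · intro i j hi hij
    have hd : (1 : ℝ) ≤ (j : ℝ) - i := by
      have : ((i + 1 : ℕ) : ℝ) ≤ j := by exact_mod_cast hij
      push_cast at this
      linarith
    by_cases hiS : i ∈ S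
    swap
    · refine (min_le_left _ _).trans ?_
      rw [_root_.smallDivisor, if_neg hiS]
      exact hone _ _ hd
    by_cases hjS : j ∈ S
    swap
    · refine (min_le_right _ _).trans ?_
      rw [_root_.smallDivisor, if_neg hjS]
      exact hone _ _ hd
    rw [_root_.smallDivisor, if_pos hiS, _root_.smallDivisor, if_pos hjS]
    -- Closure of `S` under differences makes the condition at the root `1` available for `exp ((j -
    -- i) l)`.
    have h2 := hcj' (j - i) (hS i hiS j hjS hij) (by omega)
    rw [Nat.cast_sub hij.le, Nat.cast_sub hij.le] at h2
    have h3 : c' / ((j : ℝ) - i) ^ g' ≤ ‖Complex.exp (((j : ℂ) - i) * l) - 1‖ :=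
      le_trans (le_mul_of_one_le_right (by positivity) (le_max_left _ _)) h2
    have h4 : Complex.exp (j * l) = Complex.exp (i * l) * Complex.exp (((j : ℂ) - i) * l) := by
      rw [← Complex.exp_add]
      ring_nf
    rw [h4]
    have hp1 : (1 : ℝ) ≤ ((j : ℝ) - i) ^ (g + g') := one_le_pow₀ hd
    have hp2 : ((j : ℝ) - i) ^ g' ≤ ((j : ℝ) - i) ^ (g + g') := pow_le_pow_right₀ hd (by omega)
    have hp0 : (0 : ℝ) < ((j : ℝ) - i) ^ g' := by positivity
    refine min_div_norm_sub_le ha (η := c' / ((j : ℝ) - i) ^ g') (by positivity) h3 ?_ ?_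
    · refine le_trans ?_ (le_mul_of_one_le_right (by linarith) hp1)
      linarith
    · calc 4 * (1 + 2 * ‖a‖) / (‖a‖ * (c' / ((j : ℝ) - i) ^ g'))
          = 4 * (1 + 2 * ‖a‖) / (‖a‖ * c') * ((j : ℝ) - i) ^ g' := by field_simp
        _ ≤ N * ((j : ℝ) - i) ^ (g + g') := by
            gcongr
            linarith

theorem eval_charPolynomial {n : ℕ} (A : Fin (n + 1) → ℂ) (z : ℂ) :
    (charPolynomial A).eval z = ∑ j : Fin (n + 1), A j * z ^ (j : ℕ) := by
  simp [charPolynomial, Polynomial.eval_finsetSum]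

theorem coeff_charPolynomial {n : ℕ} (A : Fin (n + 1) → ℂ) (j : Fin (n + 1)) :
    (charPolynomial A).coeff j = A j := by
  simp only [charPolynomial, Polynomial.finsetSum_coeff, Polynomial.coeff_C_mul,
    Polynomial.coeff_X_pow, mul_ite, mul_one, mul_zero]
  rw [Finset.sum_eq_single j]
  · simp
  · intro b _ hb
    rw [if_neg]
    exact fun h => hb (Fin.ext h.symm)
  · simp

theorem natDegree_charPolynomial {n : ℕ} {A : Fin (n + 1) → ℂ} (hA : A (Fin.last n) ≠ 0) :
    (charPolynomial A).natDegree = n := by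
  refine Polynomial.natDegree_eq_of_le_of_coeff_ne_zero ?_ ?_
  · refine Polynomial.natDegree_sum_le_of_forall_le _ _ fun j _ => ?_
    exact (Polynomial.natDegree_C_mul_X_pow_le _ _).trans (Nat.lt_succ_iff.1 j.2)
  · have := coeff_charPolynomial A (Fin.last n)
    rw [Fin.val_last] at this
    rwa [this]

/-- The divisors `|L (Q ^ j)|`, normalized by `max 1 |Q ^ j| ^ n`, are dominated by a Siegel
weight. -/
theorem SiegelBounded.charPolynomial {n : ℕ} {A : Fin (n + 1) → ℂ} (hAn : A (Fin.last n) ≠ 0)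
    (hA0 : A 0 ≠ 0) {S : Set ℕ} {l : ℂ} (hS : ∀ i ∈ S, ∀ j ∈ S, i < j → j - i ∈ S)
    (h : ∀ a : ℂ, (charPolynomial A).IsRoot a → LogDiophantine S l a)
    (h1 : LogDiophantine S l 1) :
    ∃ D : ℕ → ℝ, SiegelBounded D ∧ ∀ j ∈ S,
      D j = max 1 ‖Complex.exp (j * l)‖ ^ n / ‖(charPolynomial A).eval (Complex.exp (j * l))‖ := by
  set P := _root_.charPolynomial A with hP
  have hdeg : P.natDegree = n := natDegree_charPolynomial hAn
  have hlead : P.leadingCoeff = A (Fin.last n) := by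
    rw [Polynomial.leadingCoeff, hdeg]
    exact coeff_charPolynomial A (Fin.last n)
  have hP0 : P ≠ 0 := by
    intro h0
    rw [h0, Polynomial.leadingCoeff_zero] at hlead
    exact hAn hlead.symm
  have hsplit : P.Splits := IsAlgClosed.splits P
  have hcard : P.roots.card = n := by rw [← hdeg]; exact hsplit.natDegree_eq_card_roots.symm
  -- There are exactly `n` roots with multiplicity, so each takes one factor `max 1 |Q ^ j|` of the
  -- normalization.
  refine ⟨fun j => ‖A (Fin.last n)‖⁻¹ * (P.roots.map fun a => _root_.smallDivisor S l a j).prod,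
    ?_, ?_⟩
  · refine (SiegelBounded.const (by positivity)).mul (SiegelBounded.multiset_prod _ _ ?_)
    intro a ha
    have hroot : P.IsRoot a := (Polynomial.mem_roots hP0).1 ha
    refine SiegelBounded.smallDivisor ?_ hS (h a hroot) h1
    rintro rfl
    have h2 : P.coeff 0 = A 0 := coeff_charPolynomial A 0
    rw [Polynomial.coeff_zero_eq_eval_zero] at h2
    exact hA0 (h2.symm.trans hroot)
  · intro j hj
    have h2 : ∀ a, _root_.smallDivisor S l a j =
        max 1 ‖Complex.exp (j * l)‖ / ‖Complex.exp (j * l) - a‖ := fun a => if_pos hj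
    simp only [h2]
    rw [hsplit.eval_eq_prod_roots, hlead, norm_mul, Multiset.prod_map_div,
      Multiset.map_const', Multiset.prod_replicate, hcard]
    have h3 : ‖(P.roots.map fun a => Complex.exp (j * l) - a).prod‖ =
        (P.roots.map fun a => ‖Complex.exp (j * l) - a‖).prod := by
      have := map_multiset_prod (normHom : ℂ →*₀ ℝ)
        (P.roots.map fun a => Complex.exp (j * l) - a)
      rw [Multiset.map_map] at this
      exact this
    rw [h3, inv_mul_eq_div, div_div, mul_comm ‖A (Fin.last n)‖]

/-! ### Taylor formula, chain rule and evaluation of power series through truncations. -/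

namespace MvPolynomial

variable {σ R : Type*} [Fintype σ] [CommRing R] [Algebra ℂ R]

/-- Taylor's formula to first order, modulo the square of an ideal. -/
theorem aeval_add_sub_mem (J : Ideal R) (Y U : σ → R) (hU : ∀ i, U i ∈ J)
    (P : MvPolynomial σ ℂ) :
    aeval (fun i => Y i + U i) P - aeval Y P - ∑ i, aeval Y (pderiv i P) * U i ∈ J ^ 2 := by
  classical
  have hmem : ∀ Q : MvPolynomial σ ℂ, aeval (fun i => Y i + U i) Q - aeval Y Q -
      ∑ i, aeval Y (pderiv i Q) * U i ∈ J ^ 2 → aeval (fun i => Y i + U i) Q - aeval Y Q ∈ J := by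
    intro Q hQ
    have h1 : ∑ i, aeval Y (pderiv i Q) * U i ∈ J :=
      J.sum_mem fun i _ => J.mul_mem_left _ (hU i)
    have h2 := J.add_mem (Ideal.pow_le_self two_ne_zero hQ) h1
    rwa [sub_add_cancel] at h2
  induction P using MvPolynomial.induction_on with
  | C a => simp
  | add p q hp hq =>
    have := (J ^ 2).add_mem hp hq
    simp only [map_add, add_mul, Finset.sum_add_distrib] at this ⊢
    convert this using 1
    ring
  | mul_X p k hp =>
    have h1 := (J ^ 2).mul_mem_right (Y k) hp
    have h2 : (aeval (fun i => Y i + U i) p - aeval Y p) * U k ∈ J ^ 2 := by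
      rw [pow_two]
      exact Ideal.mul_mem_mul (hmem p hp) (hU k)
    have h3 : ∑ i, aeval Y (pderiv i (p * X k)) * U i =
        (∑ i, aeval Y (pderiv i p) * U i) * Y k + aeval Y p * U k := by
      simp only [pderiv_mul, map_add, map_mul, aeval_X, add_mul, Finset.sum_add_distrib,
        Finset.sum_mul]
      congr 1
      · refine Finset.sum_congr rfl fun i _ => by ring
      · rw [Finset.sum_eq_single k]
        · simp
        · intro i _ hi
          simp [pderiv_X_of_ne hi.symm]
        · simp
    rw [h3]
    have := (J ^ 2).add_mem h1 h2
    simp only [map_mul, aeval_X]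
    convert this using 1
    ring

/-- The chain rule for a derivation applied to the value of a polynomial. -/
theorem derivation_aeval (D : R → R) (hadd : ∀ a b, D (a + b) = D a + D b)
    (hmul : ∀ a b, D (a * b) = D a * b + a * D b) (hC : ∀ c : ℂ, D (algebraMap ℂ R c) = 0)
    (Y : σ → R) (P : MvPolynomial σ ℂ) :
    D (aeval Y P) = ∑ i, aeval Y (pderiv i P) * D (Y i) := by
  classical
  induction P using MvPolynomial.induction_on with
  | C a => simp [hC]
  | add p q hp hq => simp [hadd, hp, hq, add_mul, Finset.sum_add_distrib]
  | mul_X p k hp =>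
    simp only [pderiv_mul, map_add, map_mul, aeval_X, add_mul, Finset.sum_add_distrib, hmul, hp,
      Finset.sum_mul]
    congr 1
    · refine Finset.sum_congr rfl fun i _ => by ring
    · rw [Finset.sum_eq_single k]
      · simp
      · intro i _ hi
        simp [pderiv_X_of_ne hi.symm]
      · simp

end MvPolynomial

namespace MvPowerSeries

variable {σ : Type*} [Fintype σ]

theorem truncTotal_pderiv (N : ℕ) (i : σ) (f : MvPowerSeries σ ℂ) :
    truncTotal N (pderiv ℂ i f) = MvPolynomial.pderiv i (truncTotal (N + 1) f) := by
  classical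
  ext p
  rw [MvPolynomial.coeff_pderiv, coeff_truncTotal_eq_ite, coeff_truncTotal_eq_ite, coeff_pderiv]
  simp only [map_add, Finsupp.degree_single, Nat.add_lt_add_iff_right]
  split_ifs <;> simp

variable {R : Type*} [CommRing R] [Algebra ℂ R]

/-- If all monomials of large degree have vanishing coefficients at `Y`, a power series can be
evaluated at `Y` through any sufficiently long truncation. -/
theorem finsum_coeff_mul_eq_aeval (c : R →ₗ[ℂ] ℂ) (Y : σ → R) (N : ℕ)
    (hN : ∀ p : σ →₀ ℕ, N ≤ p.degree → c (∏ i, Y i ^ p i) = 0) (f : MvPowerSeries σ ℂ) :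
    ∑ᶠ p : σ →₀ ℕ, coeff p f * c (∏ i, Y i ^ p i) =
      c (MvPolynomial.aeval Y (truncTotal N f)) := by
  rw [MvPolynomial.aeval_def, MvPolynomial.eval₂_eq', map_sum]
  rw [finsum_eq_sum_of_support_subset (s := (truncTotal N f).support)]
  · refine Finset.sum_congr rfl fun p hp => ?_
    have h1 : p.degree < N := by
      by_contra! h
      exact (MvPolynomial.mem_support_iff.1 hp) (coeff_truncTotal_eq_zero f h)
    rw [coeff_truncTotal f h1, ← Algebra.smul_def, map_smul, smul_eq_mul]
  · intro p hp
    rw [Function.mem_support] at hp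
    have h1 : p.degree < N := by
      by_contra! h
      exact hp (by rw [hN p h, mul_zero])
    rw [Finset.mem_coe, MvPolynomial.mem_support_iff, coeff_truncTotal f h1]
    exact fun h => hp (by rw [h, zero_mul])

end MvPowerSeries

/-! ### Products of Siegel weights. -/

section Weights

variable {D Λ : ℕ → ℝ} {N : ℝ} {γ : ℕ}

/-- A sum of positive integers is at most the product of their doubles, up to the initial term. -/
theorem add_sum_le_mul_prod {ι : Type*} (T : Finset ι) (l : ι → ℕ) (hl : ∀ i ∈ T, 1 ≤ l i)
    (g : ℕ) : g + ∑ i ∈ T, l i ≤ (g + 1) * ∏ i ∈ T, (2 * l i) := by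
  classical
  induction T using Finset.induction_on with
  | empty => simp
  | insert a T ha ih =>
    rw [Finset.sum_insert ha, Finset.prod_insert ha]
    have h1 := ih fun i hi => hl i (Finset.mem_insert_of_mem hi)
    have h2 := hl a (Finset.mem_insert_self _ _)
    have h3 : 1 ≤ (g + 1) * ∏ i ∈ T, (2 * l i) := by
      refine Nat.one_le_iff_ne_zero.2 (mul_ne_zero (by omega) (Finset.prod_ne_zero_iff.2 ?_))
      intro i hi
      have := hl i (Finset.mem_insert_of_mem hi)
      omega
    nlinarith

/-- Multiplication of Siegel weights by a small divisor: all but the largest weight are absorbed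
by the polynomial factors. -/
theorem mul_prod_weight_le (hN : 1 ≤ N)
    (h1 : ∀ j, 1 ≤ j → 0 ≤ D j ∧ D j ≤ Λ j ∧ Λ j ≤ N * (j : ℝ) ^ γ)
    (h2 : ∀ i j, 1 ≤ i → i < j → D j * Λ i ≤ N * ((j : ℝ) - i) ^ γ * Λ j)
    {ι : Type*} (T : Finset ι) (l : ι → ℕ) (j g : ℕ) (hj : 1 ≤ j)
    (hl : ∀ i ∈ T, 1 ≤ l i ∧ l i < j) (hg : j ≤ g + ∑ i ∈ T, l i) :
    D j * ∏ i ∈ T, Λ (l i) / (l i : ℝ) ^ (2 * γ) ≤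
      (N * 2 ^ (3 * γ)) ^ T.card * ((g : ℝ) + 1) ^ (3 * γ) * (Λ j / (j : ℝ) ^ (2 * γ)) := by
  classical
  have hΛ : ∀ j, 1 ≤ j → 0 ≤ Λ j := fun j hj => (h1 j hj).1.trans (h1 j hj).2.1
  have hj0 : (0 : ℝ) < j := by exact_mod_cast hj
  have hg0 : (1 : ℝ) ≤ (g : ℝ) + 1 := by linarith [Nat.cast_nonneg (α := ℝ) g]
  rcases T.eq_empty_or_nonempty with rfl | hne
  · have hjg : (j : ℝ) ≤ (g : ℝ) + 1 := by
      have : j ≤ g := by simpa using hg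
      have : (j : ℝ) ≤ g := by exact_mod_cast this
      linarith
    simp only [Finset.prod_empty, mul_one, Finset.card_empty, pow_zero, one_mul]
    refine (h1 j hj).2.1.trans ?_
    rw [mul_div_assoc', le_div_iff₀ (by positivity), mul_comm]
    refine mul_le_mul_of_nonneg_right ?_ (hΛ j hj)
    exact (pow_le_pow_left₀ hj0.le hjg _).trans (pow_le_pow_right₀ hg0 (by omega))
  · obtain ⟨a, ha, hmax⟩ := T.exists_max_image l hne
    obtain ⟨ha1, haj⟩ := hl a ha
    have haj' : (l a : ℝ) < j := by exact_mod_cast haj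
    have ha0 : (0 : ℝ) < l a := by exact_mod_cast ha1
    set T' := T.erase a with hT'
    have hT'sub : ∀ i ∈ T', i ∈ T := fun i hi => Finset.mem_of_mem_erase hi
    have hcard : T.card = T'.card + 1 := (Finset.card_erase_add_one ha).symm
    rw [← Finset.mul_prod_erase T _ ha]
    -- Of the exponent `2 * γ`, one half cancels the growth of `Λ`; the other half pays for the gap
    -- `j - l a`, which is bounded by the product of the remaining indices.
    have hrest : ∏ i ∈ T', Λ (l i) / (l i : ℝ) ^ (2 * γ) ≤ ∏ i ∈ T', N / (l i : ℝ) ^ γ := by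
      refine Finset.prod_le_prod (fun i hi => ?_) fun i hi => ?_
      · exact div_nonneg (hΛ _ (hl i (hT'sub i hi)).1) (by positivity)
      · have hi1 := (hl i (hT'sub i hi)).1
        have hi0 : (0 : ℝ) < l i := by exact_mod_cast hi1
        rw [div_le_div_iff₀ (by positivity) (by positivity)]
        have h3 := (h1 (l i) hi1).2.2
        calc Λ (l i) * (l i : ℝ) ^ γ ≤ N * (l i : ℝ) ^ γ * (l i : ℝ) ^ γ := by gcongr
          _ = N * (l i : ℝ) ^ (2 * γ) := by rw [two_mul, pow_add]; ring
    have hgap : (j : ℝ) - l a ≤ ((g : ℝ) + 1) * ∏ i ∈ T', (2 * (l i : ℝ)) := by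
      have h3 := add_sum_le_mul_prod T' l (fun i hi => (hl i (hT'sub i hi)).1) g
      have h4 : j ≤ l a + (g + ∑ i ∈ T', l i) := by
        rw [← Finset.add_sum_erase T l ha, ← hT'] at hg
        omega
      have h5 : (j : ℝ) ≤ l a + ((g + 1) * ∏ i ∈ T', (2 * l i) : ℕ) := by
        exact_mod_cast h4.trans (by omega)
      push_cast at h5
      linarith
    -- The largest index is comparable with `j`, so its own factor `(l a) ^ (-2γ)` supplies the one
    -- required at `j`.
    have hjle : (j : ℝ) ≤ ((g : ℝ) + 1) * 2 ^ T.card * l a := by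
      have h3 : ∑ i ∈ T, l i ≤ T.card * l a := by
        simpa using Finset.sum_le_card_nsmul T l (l a) hmax
      have h4 : T.card ≤ 2 ^ T.card := Nat.lt_two_pow_self.le
      have h5 : 1 ≤ 2 ^ T.card * l a := Nat.one_le_iff_ne_zero.2 (by positivity)
      have h6 : j ≤ (g + 1) * (2 ^ T.card * l a) := by
        calc j ≤ g + T.card * l a := hg.trans (by omega)
          _ ≤ g * (2 ^ T.card * l a) + 2 ^ T.card * l a := by
              gcongr
              exact Nat.le_mul_of_pos_right _ h5
          _ = _ := by ring
      have h7 : (j : ℝ) ≤ ((g + 1) * (2 ^ T.card * l a) : ℕ) := by exact_mod_cast h6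
      push_cast at h7
      linarith
    have hP1 : 0 ≤ ∏ i ∈ T', N / (l i : ℝ) ^ γ :=
      Finset.prod_nonneg fun i _ => by positivity
    have hP2 : ∏ i ∈ T', (2 * (l i : ℝ)) ^ γ * (N / (l i : ℝ) ^ γ) = (2 ^ γ * N) ^ T'.card := by
      rw [← Finset.prod_const]
      refine Finset.prod_congr rfl fun i hi => ?_
      have hi0 : (0 : ℝ) < l i := by exact_mod_cast (hl i (hT'sub i hi)).1
      rw [mul_pow]
      field_simp
    have hDΛ : D j * Λ (l a) ≤ N * (((g : ℝ) + 1) ^ γ * ∏ i ∈ T', (2 * (l i : ℝ)) ^ γ) * Λ j := by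
      refine (h2 (l a) j ha1 haj).trans ?_
      rw [Finset.prod_pow, ← mul_pow]
      have h3 : (0 : ℝ) ≤ j - l a := by linarith
      have h4 := hΛ j hj
      gcongr
    have hjpow : (1 : ℝ) / (l a : ℝ) ^ (2 * γ) ≤
        (((g : ℝ) + 1) * 2 ^ T.card) ^ (2 * γ) / (j : ℝ) ^ (2 * γ) := by
      rw [div_le_div_iff₀ (by positivity) (by positivity), one_mul, ← mul_pow]
      exact pow_le_pow_left₀ hj0.le hjle _
    calc D j * (Λ (l a) / (l a : ℝ) ^ (2 * γ) * ∏ i ∈ T', Λ (l i) / (l i : ℝ) ^ (2 * γ))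
        = (D j * Λ (l a)) * (1 / (l a : ℝ) ^ (2 * γ)) *
            ∏ i ∈ T', Λ (l i) / (l i : ℝ) ^ (2 * γ) := by ring
      _ ≤ (N * (((g : ℝ) + 1) ^ γ * ∏ i ∈ T', (2 * (l i : ℝ)) ^ γ) * Λ j) *
            ((((g : ℝ) + 1) * 2 ^ T.card) ^ (2 * γ) / (j : ℝ) ^ (2 * γ)) *
            ∏ i ∈ T', N / (l i : ℝ) ^ γ := by
          have h4 := hΛ j hj
          have h5 : 0 ≤ D j * Λ (l a) := mul_nonneg (h1 j hj).1 (hΛ _ ha1)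
          have h6 : 0 ≤ ∏ i ∈ T', Λ (l i) / (l i : ℝ) ^ (2 * γ) :=
            Finset.prod_nonneg fun i hi => div_nonneg (hΛ _ (hl i (hT'sub i hi)).1)
              (by positivity)
          have h7 : 0 ≤ ∏ i ∈ T', (2 * (l i : ℝ)) ^ γ :=
            Finset.prod_nonneg fun i _ => by positivity
          gcongr
      _ = N * (2 ^ γ * N) ^ T'.card * (2 ^ T.card) ^ (2 * γ) * ((g : ℝ) + 1) ^ (3 * γ) *
            (Λ j / (j : ℝ) ^ (2 * γ)) := by
          rw [← hP2, Finset.prod_mul_distrib, mul_pow, show 3 * γ = γ + 2 * γ by ring, pow_add]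
          ring
      _ ≤ _ := by
          have h4 : 0 ≤ Λ j / (j : ℝ) ^ (2 * γ) := div_nonneg (hΛ j hj) (by positivity)
          refine mul_le_mul_of_nonneg_right (mul_le_mul_of_nonneg_right ?_ (by positivity)) h4
          have h5 : (1 : ℝ) ≤ 2 ^ γ := one_le_pow₀ (by norm_num)
          calc N * (2 ^ γ * N) ^ T'.card * (2 ^ T.card) ^ (2 * γ)
              ≤ (2 ^ γ * N) * (2 ^ γ * N) ^ T'.card * (2 ^ T.card) ^ (2 * γ) := by
                gcongr
                nlinarith
            _ = (N * 2 ^ (3 * γ)) ^ T.card := by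
                rw [hcard, show 3 * γ = γ + 2 * γ by ring, pow_add 2 γ]
                ring

end Weights

/-! ### Convolution powers of the inverse squares. -/

section Convolution

/-- The power series `∑ i⁻² Xⁱ`. -/
noncomputable def invSqSeries : PowerSeries ℝ := PowerSeries.mk fun i => ((i : ℝ) ^ 2)⁻¹

theorem sum_range_inv_sq_le (m : ℕ) : ∑ i ∈ Finset.range m, ((i : ℝ) ^ 2)⁻¹ ≤ 2 := by
  have h := sum_Ioo_inv_sq_le (α := ℝ) 0 m
  have h2 : ∑ i ∈ Finset.range m, ((i : ℝ) ^ 2)⁻¹ = ∑ i ∈ Finset.Ioo 0 m, ((i : ℝ) ^ 2)⁻¹ := by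
    symm
    refine Finset.sum_subset (fun i hi => ?_) fun i hi hi' => ?_
    · simp only [Finset.mem_Ioo, Finset.mem_range] at hi ⊢
      exact hi.2
    · have : i = 0 := by
        simp only [Finset.mem_Ioo, Finset.mem_range] at hi hi'
        omega
      simp [this]
  rw [h2]
  simpa using h

/-- From `1/(ab) = (1/a + 1/b)/(a + b)` one gets `a⁻² b⁻² ≤ 2 (a+b)⁻² (a⁻² + b⁻²)`. Each
inverse-square sum is at most `2`, so each multiplication costs a factor `8`. Terms with a zero
index cause no trouble because `0⁻¹ = 0`. -/
theorem coeff_invSqSeries_pow_le (k m : ℕ) :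
    PowerSeries.coeff m (invSqSeries ^ (k + 1)) ≤ 8 ^ k * ((m : ℝ) ^ 2)⁻¹ := by
  induction k generalizing m with
  | zero => simp [invSqSeries]
  | succ k ih =>
    rw [pow_succ, PowerSeries.coeff_mul]
    have hterm : ∀ p ∈ Finset.HasAntidiagonal.antidiagonal m,
        PowerSeries.coeff p.1 (invSqSeries ^ (k + 1)) * PowerSeries.coeff p.2 invSqSeries ≤
          8 ^ k * (2 * ((m : ℝ) ^ 2)⁻¹ * (((p.1 : ℝ) ^ 2)⁻¹ + ((p.2 : ℝ) ^ 2)⁻¹)) := by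
      rintro ⟨a, b⟩ hab
      rw [Finset.HasAntidiagonal.mem_antidiagonal] at hab
      simp only at hab ⊢
      have h1 : PowerSeries.coeff b invSqSeries = ((b : ℝ) ^ 2)⁻¹ := by simp [invSqSeries]
      rw [h1]
      calc PowerSeries.coeff a (invSqSeries ^ (k + 1)) * ((b : ℝ) ^ 2)⁻¹
          ≤ 8 ^ k * ((a : ℝ) ^ 2)⁻¹ * ((b : ℝ) ^ 2)⁻¹ := by
            gcongr
            exact ih a
        _ = 8 ^ k * (((a : ℝ) ^ 2)⁻¹ * ((b : ℝ) ^ 2)⁻¹) := by ring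
        _ ≤ _ := by
            refine mul_le_mul_of_nonneg_left ?_ (by positivity)
            rcases Nat.eq_zero_or_pos a with rfl | ha
            · simp only [CharP.cast_eq_zero, ne_eq, OfNat.ofNat_ne_zero, not_false_eq_true,
                zero_pow, inv_zero, zero_mul, zero_add]
              positivity
            rcases Nat.eq_zero_or_pos b with rfl | hb
            · simp only [CharP.cast_eq_zero, ne_eq, OfNat.ofNat_ne_zero, not_false_eq_true,
                zero_pow, inv_zero, mul_zero, add_zero]
              positivity
            have ha' : (0 : ℝ) < a := by exact_mod_cast ha
            have hb' : (0 : ℝ) < b := by exact_mod_cast hb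
            have hm : (m : ℝ) = a + b := by exact_mod_cast hab.symm
            rw [hm]
            have h2 : ((a : ℝ) ^ 2)⁻¹ * ((b : ℝ) ^ 2)⁻¹ =
                (((a : ℝ) + b) ^ 2)⁻¹ * ((a : ℝ)⁻¹ + (b : ℝ)⁻¹) ^ 2 := by
              field_simp
              ring
            rw [h2, mul_comm 2 ((((a : ℝ) + b) ^ 2)⁻¹), mul_assoc]
            refine mul_le_mul_of_nonneg_left ?_ (by positivity)
            rw [← inv_pow, ← inv_pow]
            nlinarith [sq_nonneg ((a : ℝ)⁻¹ - (b : ℝ)⁻¹)]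
    refine (Finset.sum_le_sum hterm).trans ?_
    rw [← Finset.mul_sum, ← Finset.mul_sum, Finset.sum_add_distrib]
    have h3 : ∑ p ∈ Finset.HasAntidiagonal.antidiagonal m, ((p.1 : ℝ) ^ 2)⁻¹ ≤ 2 := by
      rw [Finset.Nat.sum_antidiagonal_eq_sum_range_succ (fun a _ => ((a : ℝ) ^ 2)⁻¹)]
      exact sum_range_inv_sq_le _
    have h4 : ∑ p ∈ Finset.HasAntidiagonal.antidiagonal m, ((p.2 : ℝ) ^ 2)⁻¹ ≤ 2 := by
      rw [← Finset.Nat.sum_antidiagonal_swap] at h3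
      exact h3
    calc (8 : ℝ) ^ k * (2 * ((m : ℝ) ^ 2)⁻¹ *
          (∑ p ∈ Finset.HasAntidiagonal.antidiagonal m, ((p.1 : ℝ) ^ 2)⁻¹ +
            ∑ p ∈ Finset.HasAntidiagonal.antidiagonal m, ((p.2 : ℝ) ^ 2)⁻¹))
        ≤ 8 ^ k * (2 * ((m : ℝ) ^ 2)⁻¹ * (2 + 2)) := by gcongr
      _ = 8 ^ (k + 1) * ((m : ℝ) ^ 2)⁻¹ := by rw [pow_succ]; ring

/-- Moving from index `m - g` to `j` costs `(g + 1)² ≤ 8^g`, because `j ≤ m ≤ (g + 1)(m - g)` when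
`g < m`. -/
theorem coeff_invSqSeries_pow_sub_le {g k j m : ℕ} (hj : 1 ≤ j) (hjm : j ≤ m) (hg : g ≤ m) :
    PowerSeries.coeff (m - g) (invSqSeries ^ k) ≤ 8 ^ (g + k) * ((j : ℝ) ^ 2)⁻¹ := by
  have hj0 : (0 : ℝ) < j := by exact_mod_cast hj
  have hpow : ((g : ℝ) + 1) ^ 2 ≤ 8 ^ g := by
    have h1 : (g : ℝ) + 1 ≤ 2 ^ g := by exact_mod_cast Nat.lt_two_pow_self
    calc ((g : ℝ) + 1) ^ 2 ≤ (2 ^ g) ^ 2 := by gcongr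
      _ = 4 ^ g := by rw [← pow_mul, mul_comm, pow_mul]; norm_num
      _ ≤ 8 ^ g := by gcongr; norm_num
  cases k with
  | zero =>
    rw [pow_zero, PowerSeries.coeff_one]
    split_ifs with h
    · have h2 : (j : ℝ) ≤ g + 1 := by exact_mod_cast (by omega : j ≤ g + 1)
      rw [← div_eq_mul_inv, le_div_iff₀ (by positivity), one_mul, add_zero]
      exact (pow_le_pow_left₀ hj0.le h2 2).trans hpow
    · positivity
  | succ k =>
    refine (coeff_invSqSeries_pow_le k (m - g)).trans ?_
    rcases Nat.eq_zero_or_pos (m - g) with h | h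
    · rw [h]
      simp only [CharP.cast_eq_zero, ne_eq, OfNat.ofNat_ne_zero, not_false_eq_true, zero_pow,
        inv_zero, mul_zero]
      positivity
    · have h0 : (0 : ℝ) < (m - g : ℕ) := by exact_mod_cast h
      have h1 : (j : ℝ) ≤ ((g : ℝ) + 1) * (m - g : ℕ) := by
        have : j ≤ (g + 1) * (m - g) := by
          calc j ≤ g + (m - g) := by omega
            _ ≤ g * (m - g) + (m - g) := by
              gcongr
              exact Nat.le_mul_of_pos_right _ h
            _ = _ := by ring
        exact_mod_cast this
      have h2 : (((m - g : ℕ) : ℝ) ^ 2)⁻¹ ≤ 8 ^ g * ((j : ℝ) ^ 2)⁻¹ := by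
        rw [← div_eq_mul_inv, le_div_iff₀ (by positivity), inv_mul_le_iff₀ (by positivity)]
        calc (j : ℝ) ^ 2 ≤ (((g : ℝ) + 1) * (m - g : ℕ)) ^ 2 := by gcongr
          _ = ((m - g : ℕ) : ℝ) ^ 2 * ((g : ℝ) + 1) ^ 2 := by ring
          _ ≤ _ := by gcongr
      calc (8 : ℝ) ^ k * (((m - g : ℕ) : ℝ) ^ 2)⁻¹ ≤ 8 ^ (k + 1) * (8 ^ g * ((j : ℝ) ^ 2)⁻¹) := by
            gcongr
            · norm_num
            · omega
        _ = _ := by rw [pow_add]; ring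

end Convolution

/-! ### The majorant recursion. -/

section Majorant

variable {D Λ : ℕ → ℝ} {N : ℝ} {γ : ℕ}

/-- The gain in the exponents when a coefficient of index `j` is expressed through products of
coefficients of total index `ν + j`: here `l` runs through the large indices. -/
theorem exists_exponent_gain {ι : Type*} (T : Finset ι) (l : ι → ℕ) (ν j g : ℕ)
    (hj : 2 * ν + 1 < j) (hl : ∀ i ∈ T, 2 * ν + 1 < l i ∧ l i < j)
    (hsum : g + ∑ i ∈ T, l i = ν + j) :
    ∃ h : ℕ, ∑ i ∈ T, (l i - ν - 1) + h = j - ν - 1 ∧ 1 ≤ h ∧ g + T.card ≤ (ν + 4) * h := by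
  have hs : ∑ i ∈ T, (l i - ν - 1) + T.card * (ν + 1) = ∑ i ∈ T, l i := by
    rw [← smul_eq_mul, ← Finset.sum_const, ← Finset.sum_add_distrib]
    refine Finset.sum_congr rfl fun i hi => ?_
    have := hl i hi
    omega
  set s := ∑ i ∈ T, (l i - ν - 1)
  rcases Nat.lt_or_ge T.card 2 with hc | hc
  · interval_cases hcard : T.card
    · rw [Finset.card_eq_zero] at hcard
      subst hcard
      simp only [Finset.sum_empty, add_zero, zero_mul] at hsum hs
      refine ⟨j - ν - 1, by omega, by omega, ?_⟩
      have h1 : 4 * (j - ν - 1) ≤ (ν + 4) * (j - ν - 1) := Nat.mul_le_mul_right _ (by omega)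
      omega
    · obtain ⟨a, rfl⟩ := Finset.card_eq_one.1 hcard
      have ha := hl a (by simp)
      simp only [Finset.sum_singleton] at hsum hs
      -- With a single large index the gain is positive only because `l a < j`.
      refine ⟨j - l a, by omega, by omega, ?_⟩
      obtain ⟨d, hd⟩ : ∃ d, j - l a = d + 1 := ⟨j - l a - 1, by omega⟩
      have h1 : g = ν + d + 1 := by omega
      rw [hd, h1]
      nlinarith
  · obtain ⟨c, hc'⟩ : ∃ c, T.card = c + 2 := ⟨T.card - 2, by omega⟩
    rw [hc'] at hs ⊢
    -- The shift `ν + 1` in the exponents is the least that works here: two factors save `2 (ν +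
    -- 1)`, one more than the `2ν + 1` spent on the index `ν + j` and the target's own shift.
    refine ⟨g + c * ν + (c + 1), ?_, by omega, ?_⟩
    · have : (c + 2) * (ν + 1) = c * ν + 2 * ν + c + 2 := by ring
      omega
    · nlinarith [Nat.zero_le (c * ν), Nat.zero_le (ν * (g + c * ν + (c + 1)))]

/-- The constant that absorbs all geometric losses. -/
theorem exists_absorbing_constant (N R B y : ℝ) (γ ν : ℕ) (hN : 1 ≤ N) (hR : 1 ≤ R) (hB : 1 ≤ B)
    (hy : 0 < y) (hy1 : y ≤ 1) :
    ∃ C : ℝ, 1 ≤ C ∧ ∀ g k m g' h : ℕ, g + k ≤ g' + m → m ≤ k → 1 ≤ h →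
      g' + m ≤ (ν + 4) * h →
      R ^ (g + k) * B ^ (k - m) * ((N * 2 ^ (3 * γ)) ^ m * ((g' : ℝ) + 1) ^ (3 * γ)) ≤
        C ^ h * y ^ (1 + g + k) := by
  set Z : ℝ := R * B * (N * 2 ^ (3 * γ)) with hZ
  have h2 : (1 : ℝ) ≤ 2 ^ (3 * γ) := one_le_pow₀ (by norm_num)
  have hN2 : 1 ≤ N * 2 ^ (3 * γ) := by nlinarith
  have hZ1 : 1 ≤ Z := by
    have : 1 ≤ R * B := by nlinarith
    nlinarith
  -- All losses together are at most `Z ^ (g' + m)` with `g' + m ≤ (ν + 4) h`, and `y ^ 2` suffices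
  -- since `1 + g + k ≤ 2 (ν + 4) h`.
  refine ⟨(Z / y ^ 2) ^ (ν + 4), one_le_pow₀ ?_, ?_⟩
  · rw [le_div_iff₀ (by positivity), one_mul]
    exact (pow_le_one₀ hy.le hy1).trans hZ1
  · intro g k m g' h hgk hmk hh hg'
    have hR' : R ^ (g + k) ≤ R ^ (g' + m) := pow_le_pow_right₀ hR hgk
    have hB' : B ^ (k - m) ≤ B ^ (g' + m) := pow_le_pow_right₀ hB (by omega)
    have hg2 : ((g' : ℝ) + 1) ^ (3 * γ) ≤ (N * 2 ^ (3 * γ)) ^ g' := by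
      have h1 : (g' : ℝ) + 1 ≤ 2 ^ g' := by exact_mod_cast Nat.lt_two_pow_self
      calc ((g' : ℝ) + 1) ^ (3 * γ) ≤ (2 ^ g') ^ (3 * γ) := by gcongr
        _ = (2 ^ (3 * γ)) ^ g' := by rw [← pow_mul, ← pow_mul, mul_comm]
        _ ≤ _ := by
          gcongr
          nlinarith
    have hyy : y ^ (2 * ((ν + 4) * h)) ≤ y ^ (1 + g + k) := by
      refine pow_le_pow_of_le_one hy.le hy1 ?_
      have : 1 ≤ (ν + 4) * h := Nat.one_le_iff_ne_zero.2 (by positivity)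
      omega
    calc R ^ (g + k) * B ^ (k - m) * ((N * 2 ^ (3 * γ)) ^ m * ((g' : ℝ) + 1) ^ (3 * γ))
        ≤ R ^ (g' + m) * B ^ (g' + m) *
            ((N * 2 ^ (3 * γ)) ^ m * (N * 2 ^ (3 * γ)) ^ g') := by gcongr
      _ = Z ^ (g' + m) := by rw [hZ, ← pow_add, add_comm m g', ← mul_pow, ← mul_pow]
      _ ≤ Z ^ ((ν + 4) * h) := pow_le_pow_right₀ hZ1 hg'
      _ = ((Z / y ^ 2) ^ (ν + 4)) ^ h * y ^ (2 * ((ν + 4) * h)) := by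
          rw [← pow_mul, div_pow, ← pow_mul]
          field_simp
      _ ≤ _ := by gcongr

/-- One monomial of the majorant recursion. -/
theorem smallDivisor_mul_coeff_pow_le {R B y : ℝ} {ν : ℕ} (hN : 1 ≤ N) (hR : 1 ≤ R) (hB : 1 ≤ B)
    (hy : 0 < y) (hy1 : y ≤ 1)
    (h1 : ∀ j, 1 ≤ j → 0 ≤ D j ∧ D j ≤ Λ j ∧ Λ j ≤ N * (j : ℝ) ^ γ)
    (h2 : ∀ i j, 1 ≤ i → i < j → D j * Λ i ≤ N * ((j : ℝ) - i) ^ γ * Λ j) :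
    ∃ C : ℝ, 1 ≤ C ∧ ∀ (j : ℕ) (b : ℕ → ℝ), 2 * ν + 1 < j → b 0 = 0 → (∀ i, 0 ≤ b i) →
      (∀ i, 1 ≤ i → i ≤ 2 * ν + 1 → b i ≤ B * ((i : ℝ) ^ 2)⁻¹) →
      (∀ i, 2 * ν + 1 < i → i < j →
        b i ≤ Λ i / (i : ℝ) ^ (2 * γ) * ((i : ℝ) ^ 2)⁻¹ * C ^ (i - ν - 1)) →
      (∀ i, j ≤ i → b i = 0) → ∀ g k : ℕ, g ≤ ν + j →
      D j * (R ^ (g + k) * PowerSeries.coeff (ν + j - g) (PowerSeries.mk b ^ k)) ≤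
        Λ j / (j : ℝ) ^ (2 * γ) * ((j : ℝ) ^ 2)⁻¹ * C ^ (j - ν - 1) *
          (y * (8 * y) ^ (g + k)) := by
  classical
  obtain ⟨C, hC1, hC⟩ := exists_absorbing_constant N R B y γ ν hN hR hB hy hy1
  refine ⟨C, hC1, fun j b hj hb0 hb hbs hbl hbj g k hg => ?_⟩
  have hC0 : 0 < C := by linarith
  have hΛ : ∀ j, 1 ≤ j → 0 ≤ Λ j := fun j hj => (h1 j hj).1.trans (h1 j hj).2.1
  have hj1 : 1 ≤ j := by omega
  have hw : ∀ i, 1 ≤ i → 0 ≤ Λ i / (i : ℝ) ^ (2 * γ) :=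
    fun i hi => div_nonneg (hΛ i hi) (by positivity)
  have hD := (h1 j hj1).1
  set w : ℝ := Λ j / (j : ℝ) ^ (2 * γ) with hwdef
  have hw0 : 0 ≤ w := hw j hj1
  -- the estimate for a single tuple of indices
  have htuple : ∀ l ∈ Finset.finsuppAntidiag (Finset.range k) (ν + j - g),
      D j * (R ^ (g + k) * ∏ i ∈ Finset.range k, b (l i)) ≤
        w * C ^ (j - ν - 1) * y ^ (1 + g + k) *
          ∏ i ∈ Finset.range k, ((l i : ℝ) ^ 2)⁻¹ := by
    intro l hlmem
    have hsum : ∑ i ∈ Finset.range k, l i = ν + j - g :=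
      (Finset.mem_finsuppAntidiag.1 hlmem).1
    have hrhs : 0 ≤ w * C ^ (j - ν - 1) * y ^ (1 + g + k) *
        ∏ i ∈ Finset.range k, ((l i : ℝ) ^ 2)⁻¹ :=
      mul_nonneg (by positivity) (Finset.prod_nonneg fun i _ => by positivity)
    by_cases hall : ∀ i ∈ Finset.range k, 1 ≤ l i ∧ l i < j
    swap
    · push Not at hall
      obtain ⟨i, hi, hli⟩ := hall
      have hz : b (l i) = 0 := by
        rcases Nat.eq_zero_or_pos (l i) with h | h
        · rw [h, hb0]
        · exact hbj _ (hli h)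
      rw [Finset.prod_eq_zero hi hz, mul_zero, mul_zero]
      exact hrhs
    set T := (Finset.range k).filter fun i => 2 * ν + 1 < l i with hT
    set T' := (Finset.range k).filter fun i => ¬ 2 * ν + 1 < l i with hT'
    have hTmem : ∀ i ∈ T, 2 * ν + 1 < l i ∧ l i < j := fun i hi =>
      ⟨(Finset.mem_filter.1 hi).2, (hall i (Finset.mem_filter.1 hi).1).2⟩
    have hT'mem : ∀ i ∈ T', 1 ≤ l i ∧ l i ≤ 2 * ν + 1 := fun i hi =>
      ⟨(hall i (Finset.mem_filter.1 hi).1).1, not_lt.1 (Finset.mem_filter.1 hi).2⟩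
    have hcard : T.card + T'.card = k := by
      rw [hT, hT', Finset.card_filter_add_card_filter_not, Finset.card_range]
    have hsumT : ∑ i ∈ T, l i + ∑ i ∈ T', l i = ν + j - g := by
      rw [hT, hT', Finset.sum_filter_add_sum_filter_not, hsum]
    -- Coefficients of small index are merely bounded by `B`, so their indices are counted together
    -- with the power of the independent variable.
    set g' := g + ∑ i ∈ T', l i with hg'
    have hT'card : T'.card ≤ ∑ i ∈ T', l i := by
      simpa using Finset.card_nsmul_le_sum T' l 1 fun i hi => (hT'mem i hi).1
    have hsum' : g' + ∑ i ∈ T, l i = ν + j := by omega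
    obtain ⟨h, hh1, hh2, hh3⟩ := exists_exponent_gain T l ν j g' hj hTmem hsum'
    have hW := mul_prod_weight_le hN h1 h2 T l j g' hj1
      (fun i hi => ⟨by have := hTmem i hi; omega, (hTmem i hi).2⟩) (by omega)
    have hconst := hC g k T.card g' h (by omega) (by omega) hh2 hh3
    have hprodT : ∏ i ∈ T, b (l i) ≤ (∏ i ∈ T, Λ (l i) / (l i : ℝ) ^ (2 * γ)) *
        (∏ i ∈ T, ((l i : ℝ) ^ 2)⁻¹) * C ^ (∑ i ∈ T, (l i - ν - 1)) := by
      rw [← Finset.prod_pow_eq_pow_sum, ← Finset.prod_mul_distrib, ← Finset.prod_mul_distrib]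
      exact Finset.prod_le_prod (fun i _ => hb _)
        fun i hi => hbl _ (hTmem i hi).1 (hTmem i hi).2
    have hprodT' : ∏ i ∈ T', b (l i) ≤ B ^ (k - T.card) * ∏ i ∈ T', ((l i : ℝ) ^ 2)⁻¹ := by
      have h3 : k - T.card = T'.card := by omega
      rw [h3, ← Finset.prod_const, ← Finset.prod_mul_distrib]
      exact Finset.prod_le_prod (fun i _ => hb _)
        fun i hi => hbs _ (hT'mem i hi).1 (hT'mem i hi).2
    have hsplit : ∀ F : ℕ → ℝ, ∏ i ∈ Finset.range k, F i = (∏ i ∈ T, F i) * ∏ i ∈ T', F i :=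
      fun F => (Finset.prod_filter_mul_prod_filter_not _ _ _).symm
    rw [hsplit (fun i => b (l i)), hsplit (fun i => ((l i : ℝ) ^ 2)⁻¹)]
    set P := ∏ i ∈ T, Λ (l i) / (l i : ℝ) ^ (2 * γ) with hP
    set I := ∏ i ∈ T, ((l i : ℝ) ^ 2)⁻¹ with hI
    set I' := ∏ i ∈ T', ((l i : ℝ) ^ 2)⁻¹ with hI'
    set s := ∑ i ∈ T, (l i - ν - 1) with hs
    have hI0 : 0 ≤ I := Finset.prod_nonneg fun i _ => by positivity
    have hI'0 : 0 ≤ I' := Finset.prod_nonneg fun i _ => by positivity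
    have hP0 : 0 ≤ P := Finset.prod_nonneg fun i hi => hw _ (by have := hTmem i hi; omega)
    have hQ0 : 0 ≤ ∏ i ∈ T', b (l i) := Finset.prod_nonneg fun i _ => hb _
    calc D j * (R ^ (g + k) * ((∏ i ∈ T, b (l i)) * ∏ i ∈ T', b (l i)))
        ≤ D j * (R ^ (g + k) * ((P * I * C ^ s) * (B ^ (k - T.card) * I'))) := by gcongr
      _ = (D j * P) * (R ^ (g + k) * B ^ (k - T.card) * C ^ s * (I * I')) := by ring
      _ ≤ ((N * 2 ^ (3 * γ)) ^ T.card * ((g' : ℝ) + 1) ^ (3 * γ) * w) *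
            (R ^ (g + k) * B ^ (k - T.card) * C ^ s * (I * I')) := by gcongr
      _ = (R ^ (g + k) * B ^ (k - T.card) *
            ((N * 2 ^ (3 * γ)) ^ T.card * ((g' : ℝ) + 1) ^ (3 * γ))) *
            (w * C ^ s * (I * I')) := by ring
      _ ≤ (C ^ h * y ^ (1 + g + k)) * (w * C ^ s * (I * I')) := by gcongr
      _ = _ := by rw [← hh1, pow_add]; ring
  rw [PowerSeries.coeff_pow, Finset.mul_sum, Finset.mul_sum]
  simp only [PowerSeries.coeff_mk]
  refine (Finset.sum_le_sum htuple).trans ?_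
  rw [← Finset.mul_sum]
  have hconv := coeff_invSqSeries_pow_sub_le (g := g) (k := k) (m := ν + j) hj1 (by omega) hg
  rw [PowerSeries.coeff_pow] at hconv
  simp only [invSqSeries, PowerSeries.coeff_mk] at hconv
  calc _ ≤ w * C ^ (j - ν - 1) * y ^ (1 + g + k) * (8 ^ (g + k) * ((j : ℝ) ^ 2)⁻¹) := by gcongr
    _ = _ := by rw [mul_pow, add_assoc, pow_add y 1]; ring

end Majorant

/-! ### The coefficient recursion for power series solutions. -/

/-- The power series `tˢ, ψ(t), ψ(Qt), …, ψ(Qⁿt)`. -/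
noncomputable def shiftTuple (n s : ℕ) (Q : ℂ) (ψ : PowerSeries ℂ) :
    Fin (n + 2) → PowerSeries ℂ :=
  Fin.cons (PowerSeries.X ^ s) fun i : Fin (n + 1) => PowerSeries.rescale (Q ^ (i : ℕ)) ψ

section Recursion

variable {n s : ℕ} {Q : ℂ} {ψ : PowerSeries ℂ}

theorem X_dvd_shiftTuple (hs : 1 ≤ s) (hψ : PowerSeries.coeff 0 ψ = 0) (i : Fin (n + 2)) :
    PowerSeries.X ∣ shiftTuple n s Q ψ i := by
  refine Fin.cases ?_ (fun j => ?_) i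
  · exact dvd_pow_self _ (by omega)
  · simp only [shiftTuple, Fin.cons_succ]
    rw [PowerSeries.X_dvd_iff, ← PowerSeries.coeff_zero_eq_constantCoeff_apply,
      PowerSeries.coeff_rescale, hψ, mul_zero]

theorem coeff_prod_shiftTuple_eq_zero (hs : 1 ≤ s) (hψ : PowerSeries.coeff 0 ψ = 0) {k : ℕ}
    (p : Fin (n + 2) →₀ ℕ) (hp : k + 1 ≤ p.degree) :
    PowerSeries.coeff k (∏ i, shiftTuple n s Q ψ i ^ p i) = 0 := by
  have h1 : (PowerSeries.X : PowerSeries ℂ) ^ p.degree ∣ ∏ i, shiftTuple n s Q ψ i ^ p i := by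
    rw [Finsupp.degree_eq_sum, ← Finset.prod_pow_eq_pow_sum]
    exact Finset.prod_dvd_prod_of_dvd _ _ fun i _ =>
      pow_dvd_pow_of_dvd (X_dvd_shiftTuple hs hψ i) _
  exact PowerSeries.X_pow_dvd_iff.1 h1 k (by omega)

theorem finsum_shiftTuple_eq (hs : 1 ≤ s) (hψ : PowerSeries.coeff 0 ψ = 0) {k N : ℕ}
    (hN : k + 1 ≤ N) (f : MvPowerSeries (Fin (n + 2)) ℂ) :
    ∑ᶠ p : Fin (n + 2) →₀ ℕ, MvPowerSeries.coeff p f *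
        PowerSeries.coeff k (∏ i, shiftTuple n s Q ψ i ^ p i) =
      PowerSeries.coeff k (MvPolynomial.aeval (shiftTuple n s Q ψ)
        (MvPowerSeries.truncTotal N f)) :=
  MvPowerSeries.finsum_coeff_mul_eq_aeval (PowerSeries.coeff k) _ N
    (fun p hp => coeff_prod_shiftTuple_eq_zero hs hψ p (hN.trans hp)) f

/-- The recursion for the coefficients of a formal solution. -/
theorem coeff_aeval_trunc_eq (hs : 1 ≤ s) (hψ : PowerSeries.coeff 0 ψ = 0)
    {f : MvPowerSeries (Fin (n + 2)) ℂ}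
    (hsol : ∀ k, ∑ᶠ p : Fin (n + 2) →₀ ℕ, MvPowerSeries.coeff p f *
        PowerSeries.coeff k (∏ i, shiftTuple n s Q ψ i ^ p i) = 0)
    {ν : ℕ} {A : Fin (n + 1) → ℂ}
    (hA : ∀ i : Fin (n + 1), ∀ k ≤ ν, ∑ᶠ p : Fin (n + 2) →₀ ℕ,
      MvPowerSeries.coeff p (MvPowerSeries.pderiv ℂ i.succ f) *
        PowerSeries.coeff k (∏ i, shiftTuple n s Q ψ i ^ p i) = if k = ν then A i else 0)
    {j : ℕ} (hj : ν < j) :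
    PowerSeries.coeff (ν + j) (MvPolynomial.aeval
        (shiftTuple n s Q (PowerSeries.trunc j ψ : PowerSeries ℂ))
        (MvPowerSeries.truncTotal (ν + j + 2) f)) =
      -((charPolynomial A).eval (Q ^ j) * PowerSeries.coeff j ψ) := by
  set P := MvPowerSeries.truncTotal (ν + j + 2) f with hP
  set Y := shiftTuple n s Q ψ with hY
  have hXj : (PowerSeries.X : PowerSeries ℂ) ^ j ∣ (PowerSeries.trunc j ψ : PowerSeries ℂ) - ψ := by
    rw [PowerSeries.X_pow_dvd_iff]
    intro m hm
    rw [map_sub, Polynomial.coeff_coe, PowerSeries.coeff_trunc, if_pos hm, sub_self]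
  obtain ⟨V, hV⟩ := hXj
  set W : Fin (n + 2) → PowerSeries ℂ := Fin.cons 0 fun i : Fin (n + 1) =>
    PowerSeries.C (Q ^ (i : ℕ)) ^ j * PowerSeries.rescale (Q ^ (i : ℕ)) V with hW
  have hYU : shiftTuple n s Q (PowerSeries.trunc j ψ : PowerSeries ℂ) =
      fun i => Y i + PowerSeries.X ^ j * W i := by
    funext i
    refine Fin.cases ?_ (fun i => ?_) i
    · simp [hY, hW, shiftTuple]
    · simp only [hY, hW, shiftTuple, Fin.cons_succ]
      rw [← sub_eq_iff_eq_add', ← map_sub, hV, map_mul, map_pow, PowerSeries.rescale_X]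
      ring
  have hTaylor := MvPolynomial.aeval_add_sub_mem (Ideal.span {(PowerSeries.X : PowerSeries ℂ) ^ j})
    Y (fun i => PowerSeries.X ^ j * W i)
    (fun i => Ideal.mem_span_singleton.2 (dvd_mul_right _ _)) P
  rw [Ideal.span_singleton_pow, Ideal.mem_span_singleton, ← pow_mul] at hTaylor
  -- Truncating `ψ` at order `j` perturbs the arguments by multiples of `X ^ j`. The quadratic
  -- remainder starts at order `2 j > ν + j` and is invisible here.
  have h0 := PowerSeries.X_pow_dvd_iff.1 hTaylor (ν + j) (by omega)
  rw [map_sub, map_sub, map_sum, sub_eq_zero, sub_eq_iff_eq_add] at h0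
  rw [hYU, h0, hP, ← finsum_shiftTuple_eq hs hψ (by omega) f, hsol, add_zero]
  have hterm : ∀ i : Fin (n + 1), PowerSeries.coeff (ν + j)
      (MvPolynomial.aeval Y (MvPolynomial.pderiv i.succ P) * (PowerSeries.X ^ j * W i.succ)) =
      -(A i * (Q ^ j) ^ (i : ℕ) * PowerSeries.coeff j ψ) := by
    intro i
    have h1 : ∀ k ≤ ν, PowerSeries.coeff k (MvPolynomial.aeval Y (MvPolynomial.pderiv i.succ P)) =
        if k = ν then A i else 0 := by
      intro k hk
      rw [hP, ← MvPowerSeries.truncTotal_pderiv, ← hA i k hk]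
      exact (finsum_shiftTuple_eq hs hψ (by omega) _).symm
    have h2 : PowerSeries.coeff 0 (W i.succ) = -((Q ^ j) ^ (i : ℕ) * PowerSeries.coeff j ψ) := by
      have h3 : PowerSeries.coeff 0 V = - PowerSeries.coeff j ψ := by
        have h4 := congrArg (PowerSeries.coeff j) hV
        have h5 := PowerSeries.coeff_X_pow_mul V j 0
        rw [zero_add] at h5
        rw [map_sub, Polynomial.coeff_coe, PowerSeries.coeff_trunc, if_neg (lt_irrefl _),
          zero_sub, h5] at h4
        exact h4.symm
      simp only [hW, Fin.cons_succ]
      rw [← map_pow, PowerSeries.coeff_C_mul, PowerSeries.coeff_rescale, h3]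
      ring
    -- The derivative has order at least `ν`, so only its leading coefficient meets the leading
    -- coefficient of the perturbation.
    rw [mul_left_comm, PowerSeries.coeff_X_pow_mul, PowerSeries.coeff_mul,
      Finset.sum_eq_single (ν, 0)]
    · rw [h1 ν le_rfl, if_pos rfl, h2]
      ring
    · rintro ⟨a, b⟩ hab hne
      rw [Finset.HasAntidiagonal.mem_antidiagonal] at hab
      simp only at hab
      have ha : a ≠ ν := by
        rintro rfl
        exact hne (by rw [show b = 0 by omega])
      rw [h1 a (by omega), if_neg ha, zero_mul]
    · intro h
      exact absurd (Finset.HasAntidiagonal.mem_antidiagonal.2 (by simp)) h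
  rw [Fin.sum_univ_succ]
  have hzero : W 0 = 0 := by simp [hW]
  rw [hzero, mul_zero, mul_zero, map_zero, zero_add, Finset.sum_congr rfl fun i _ => hterm i,
    eval_charPolynomial, Finset.sum_mul, Finset.sum_neg_distrib]

end Recursion

/-! ### Majorants and geometric bounds for the coefficients. -/

namespace PowerSeries

/-- The real power series `b` majorizes the complex power series `a`. -/
def IsMajorizedBy (a : PowerSeries ℂ) (b : PowerSeries ℝ) : Prop :=
  ∀ k, ‖coeff k a‖ ≤ coeff k b

namespace IsMajorizedBy

theorem one : IsMajorizedBy 1 1 := by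
  intro k
  rw [coeff_one, coeff_one]
  split_ifs <;> simp

theorem mul {a a' : PowerSeries ℂ} {b b' : PowerSeries ℝ} (h : IsMajorizedBy a b)
    (h' : IsMajorizedBy a' b') : IsMajorizedBy (a * a') (b * b') := by
  intro k
  rw [coeff_mul, coeff_mul]
  refine (norm_sum_le _ _).trans (Finset.sum_le_sum fun p _ => ?_)
  rw [norm_mul]
  exact mul_le_mul (h _) (h' _) (norm_nonneg _) ((norm_nonneg _).trans (h _))

theorem pow {a : PowerSeries ℂ} {b : PowerSeries ℝ} (h : IsMajorizedBy a b) (k : ℕ) :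
    IsMajorizedBy (a ^ k) (b ^ k) := by
  induction k with
  | zero => simpa using one
  | succ k ih => simpa [pow_succ] using ih.mul h

theorem prod {ι : Type*} (s : Finset ι) {a : ι → PowerSeries ℂ} {b : ι → PowerSeries ℝ}
    (h : ∀ i ∈ s, IsMajorizedBy (a i) (b i)) : IsMajorizedBy (∏ i ∈ s, a i) (∏ i ∈ s, b i) := by
  classical
  induction s using Finset.induction_on with
  | empty => simpa using one
  | insert i s hi ih =>
    rw [Finset.prod_insert hi, Finset.prod_insert hi]
    exact (h i (Finset.mem_insert_self _ _)).mul
      (ih fun j hj => h j (Finset.mem_insert_of_mem hj))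

end IsMajorizedBy

end PowerSeries

section Majorization

/-- The sum is dominated by a product of `m` geometric sums, each at most `2`. -/
theorem sum_pow_degree_le {m : ℕ} (F : Finset (Fin m →₀ ℕ)) {z : ℝ} (hz : 0 ≤ z)
    (hz2 : z ≤ 1 / 2) : ∑ p ∈ F, z ^ p.degree ≤ 2 ^ m := by
  classical
  obtain ⟨K, hK⟩ : ∃ K, ∀ p ∈ F, ∀ i, p i < K := by
    refine ⟨F.sup Finsupp.degree + 1, fun p hp i => ?_⟩
    have h1 := Finset.le_sup (f := Finsupp.degree) hp
    have h2 := Finsupp.le_degree i p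
    omega
  have h1 : ∑ p ∈ F, z ^ p.degree ≤
      ∑ x ∈ Fintype.piFinset fun _ : Fin m => Finset.range K, ∏ i, z ^ x i := by
    have h2 : ∑ p ∈ F, z ^ p.degree = ∑ x ∈ F.image (fun p : Fin m →₀ ℕ => (p : Fin m → ℕ)),
        ∏ i, z ^ x i := by
      rw [Finset.sum_image fun p _ q _ h => DFunLike.coe_injective h]
      refine Finset.sum_congr rfl fun p _ => ?_
      rw [Finset.prod_pow_eq_pow_sum, Finsupp.degree_eq_sum]
    rw [h2]
    refine Finset.sum_le_sum_of_subset_of_nonneg ?_ fun x _ _ =>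
      Finset.prod_nonneg fun i _ => by positivity
    intro x hx
    obtain ⟨p, hp, rfl⟩ := Finset.mem_image.1 hx
    exact Fintype.mem_piFinset.2 fun i => Finset.mem_range.2 (hK p hp i)
  refine h1.trans ?_
  rw [← Finset.prod_univ_sum]
  have h3 : ∑ k ∈ Finset.range K, z ^ k ≤ 2 := by
    have h4 : ∑ k ∈ Finset.range K, z ^ k ≤ ∑ k ∈ Finset.range K, (1 / 2 : ℝ) ^ k :=
      Finset.sum_le_sum fun k _ => pow_le_pow_left₀ hz hz2 k
    refine h4.trans ?_
    have h5 := sum_geometric_two_le K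
    simpa using h5
  have h4 : ∏ _i : Fin m, ∑ k ∈ Finset.range K, z ^ k ≤ ∏ _i : Fin m, (2 : ℝ) :=
    Finset.prod_le_prod (fun i _ => Finset.sum_nonneg fun k _ => by positivity) fun i _ => h3
  simpa using h4

/-- One majorant serves all the rescaled series, so a monomial enters only through its degree in `x`
and its total degree in the `y_j`. -/
theorem norm_coeff_aeval_shiftTuple_le {n s : ℕ} {Q : ℂ} {ψ : PowerSeries ℂ} {b : PowerSeries ℝ}
    (hb : ∀ i ≤ n, (PowerSeries.rescale (Q ^ i) ψ).IsMajorizedBy b) {K B : ℝ}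
    {P : MvPolynomial (Fin (n + 2)) ℂ} (hP : ∀ p, ‖P.coeff p‖ ≤ K * B ^ p.degree) (M : ℕ) :
    ‖PowerSeries.coeff M (MvPolynomial.aeval (shiftTuple n s Q ψ) P)‖ ≤
      ∑ p ∈ P.support, K * B ^ p.degree * PowerSeries.coeff M
        (PowerSeries.X ^ (s * p 0) * b ^ ∑ i : Fin (n + 1), p i.succ) := by
  rw [MvPolynomial.aeval_def, MvPolynomial.eval₂_eq', map_sum]
  refine (norm_sum_le _ _).trans (Finset.sum_le_sum fun p _ => ?_)
  rw [← Algebra.smul_def, map_smul, norm_smul]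
  refine mul_le_mul (hP p) ?_ (norm_nonneg _) ((norm_nonneg _).trans (hP p))
  have hmaj : (∏ i, shiftTuple n s Q ψ i ^ p i).IsMajorizedBy
      (PowerSeries.X ^ (s * p 0) * b ^ ∑ i : Fin (n + 1), p i.succ) := by
    rw [Fin.prod_univ_succ, ← Finset.prod_pow_eq_pow_sum]
    refine PowerSeries.IsMajorizedBy.mul ?_ (PowerSeries.IsMajorizedBy.prod _ fun i _ => ?_)
    · intro k
      simp only [shiftTuple, Fin.cons_zero]
      rw [← pow_mul, PowerSeries.coeff_X_pow, PowerSeries.coeff_X_pow]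
      split_ifs <;> simp
    · simp only [shiftTuple, Fin.cons_succ]
      exact (hb i (Nat.lt_succ_iff.1 i.2)).pow _
  exact hmaj M

end Majorization

/-- A formal power series solution of a `q`-difference equation whose linearization has
controlled small divisors converges. -/
theorem exists_norm_coeff_le_pow {n s : ℕ} {Q : ℂ} {ψ : PowerSeries ℂ} (hs : 1 ≤ s)
    (hψ : PowerSeries.coeff 0 ψ = 0) {f : MvPowerSeries (Fin (n + 2)) ℂ} {K B : ℝ}
    (hf : ∀ p, ‖MvPowerSeries.coeff p f‖ ≤ K * B ^ p.degree) (hK : 0 ≤ K) (hB : 1 ≤ B)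
    (hsol : ∀ k, ∑ᶠ p : Fin (n + 2) →₀ ℕ, MvPowerSeries.coeff p f *
        PowerSeries.coeff k (∏ i, shiftTuple n s Q ψ i ^ p i) = 0)
    {ν : ℕ} {A : Fin (n + 1) → ℂ}
    (hA : ∀ i : Fin (n + 1), ∀ k ≤ ν, ∑ᶠ p : Fin (n + 2) →₀ ℕ,
      MvPowerSeries.coeff p (MvPowerSeries.pderiv ℂ i.succ f) *
        PowerSeries.coeff k (∏ i, shiftTuple n s Q ψ i ^ p i) = if k = ν then A i else 0)
    {S : Set ℕ} (hS : ∀ j ∉ S, PowerSeries.coeff j ψ = 0) {D : ℕ → ℝ} (hD : SiegelBounded D)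
    (hDS : ∀ j ∈ S, D j = max 1 ‖Q ^ j‖ ^ n / ‖(charPolynomial A).eval (Q ^ j)‖)
    (hL : ∀ j ∈ S, 1 ≤ j → (charPolynomial A).eval (Q ^ j) ≠ 0) :
    ∃ C : ℝ, 1 ≤ C ∧ ∀ j, ‖PowerSeries.coeff j ψ‖ ≤ C ^ j := by
  obtain ⟨Λ, N, γ, hN, h1, h2⟩ := hD
  -- This normalization dominates the `j`-th coefficient of `ψ(Qⁱ t)` for all `i ≤ n` at once,
  -- whether `|Q|` is larger or smaller than `1`.
  set b : ℕ → ℝ := fun j => max 1 ‖Q ^ j‖ ^ n * ‖PowerSeries.coeff j ψ‖ with hbdef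
  have hb0 : b 0 = 0 := by simp [hbdef, hψ]
  have hbnn : ∀ j, 0 ≤ b j := fun j => by positivity
  have hΛ : ∀ j, 1 ≤ j → 0 ≤ Λ j := fun j hj => (h1 j hj).1.trans (h1 j hj).2.1
  have hcb : ∀ j, ∀ i ≤ n, ‖Q ^ i‖ ^ j * ‖PowerSeries.coeff j ψ‖ ≤ b j := by
    intro j i hi
    refine mul_le_mul_of_nonneg_right ?_ (norm_nonneg _)
    have h3 : ‖Q ^ i‖ ^ j = ‖Q ^ j‖ ^ i := by rw [norm_pow, norm_pow, ← pow_mul, ← pow_mul, mul_comm]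
    rw [h3]
    exact (pow_le_pow_left₀ (norm_nonneg _) (le_max_right 1 _) i).trans
      (pow_le_pow_right₀ (le_max_left _ _) hi)
  -- a bound for the initial coefficients
  obtain ⟨B₂, hB₂1, hB₂⟩ : ∃ B₂ : ℝ, 1 ≤ B₂ ∧ ∀ i, 1 ≤ i → i ≤ 2 * ν + 1 →
      b i ≤ B₂ * ((i : ℝ) ^ 2)⁻¹ := by
    refine ⟨1 + ∑ i ∈ Finset.range (2 * ν + 2), (i : ℝ) ^ 2 * b i, ?_, fun i hi1 hi2 => ?_⟩
    · have : 0 ≤ ∑ i ∈ Finset.range (2 * ν + 2), (i : ℝ) ^ 2 * b i :=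
        Finset.sum_nonneg fun i _ => mul_nonneg (by positivity) (hbnn i)
      linarith
    · have h3 := Finset.single_le_sum (f := fun i : ℕ => (i : ℝ) ^ 2 * b i)
        (fun i _ => mul_nonneg (by positivity) (hbnn i))
        (Finset.mem_range.2 (by omega : i < 2 * ν + 2))
      have hi0 : (0 : ℝ) < i := by exact_mod_cast hi1
      rw [← div_eq_mul_inv, le_div_iff₀ (by positivity), mul_comm]
      linarith
  -- the constant `y` makes the sum over all monomials small
  set y : ℝ := min (1 / 16) (1 / ((K + 1) * 2 ^ (n + 2))) with hy
  have hy0 : 0 < y := by positivity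
  have hy16 : y ≤ 1 / 16 := min_le_left _ _
  have hyK : K * (y * 2 ^ (n + 2)) ≤ 1 := by
    have h3 : y * ((K + 1) * 2 ^ (n + 2)) ≤ 1 := by
      rw [← le_div_iff₀ (by positivity)]
      exact min_le_right _ _
    have h4 : 0 ≤ y * 2 ^ (n + 2) := by positivity
    nlinarith
  obtain ⟨C, hC1, hC⟩ := smallDivisor_mul_coeff_pow_le (ν := ν) hN hB hB₂1 hy0
    (hy16.trans (by norm_num)) h1 h2
  have hC0 : 0 < C := by linarith
  have hmain : ∀ j, 2 * ν + 1 < j →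
      b j ≤ Λ j / (j : ℝ) ^ (2 * γ) * ((j : ℝ) ^ 2)⁻¹ * C ^ (j - ν - 1) := by
    intro j
    induction j using Nat.strong_induction_on with
    | _ j ih =>
    intro hj
    have hj1 : 1 ≤ j := by omega
    set target := Λ j / (j : ℝ) ^ (2 * γ) * ((j : ℝ) ^ 2)⁻¹ * C ^ (j - ν - 1) with htarget
    have ht0 : 0 ≤ target := by
      have := hΛ j hj1
      positivity
    by_cases hjS : j ∈ S
    swap
    · have : b j = 0 := by simp [hbdef, hS j hjS]
      rw [this]
      exact ht0
    set b' : ℕ → ℝ := fun i => if i < j then b i else 0 with hb'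
    have hb'nn : ∀ i, 0 ≤ b' i := fun i => by
      simp only [hb']
      split_ifs
      · exact hbnn i
      · exact le_rfl
    have hmono := hC j b' hj (by simp [hb', hb0]) hb'nn
      (fun i hi1 hi2 => by
        simp only [hb']
        rw [if_pos (by omega)]
        exact hB₂ i hi1 hi2)
      (fun i hi1 hi2 => by
        simp only [hb']
        rw [if_pos hi2]
        exact ih i hi2 hi1)
      (fun i hi => by simp only [hb']; rw [if_neg (by omega)])
    have hrec := coeff_aeval_trunc_eq hs hψ hsol hA (j := j) (by omega)
    have hmaj : ∀ i ≤ n, (PowerSeries.rescale (Q ^ i)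
        (PowerSeries.trunc j ψ : PowerSeries ℂ)).IsMajorizedBy (PowerSeries.mk b') := by
      intro i hi k
      rw [PowerSeries.coeff_rescale, Polynomial.coeff_coe, PowerSeries.coeff_trunc,
        PowerSeries.coeff_mk]
      simp only [hb']
      split_ifs with hk
      · rw [norm_mul, norm_pow]
        exact hcb k i hi
      · simp
    have hPcoeff : ∀ p, ‖(MvPowerSeries.truncTotal (ν + j + 2) f).coeff p‖ ≤ K * B ^ p.degree := by
      intro p
      rw [MvPowerSeries.coeff_truncTotal_eq_ite]
      split_ifs
      · exact hf p
      · rw [norm_zero]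
        positivity
    have hsum := norm_coeff_aeval_shiftTuple_le (s := s) hmaj hPcoeff (ν + j)
    rw [hrec, norm_neg, norm_mul] at hsum
    set F := (MvPowerSeries.truncTotal (ν + j + 2) f).support with hF
    have hD0 := (h1 j hj1).1
    have hL0 : 0 < ‖(charPolynomial A).eval (Q ^ j)‖ := norm_pos_iff.2 (hL j hjS hj1)
    -- The factor `max 1 |Q ^ j| ^ n` is part of `D`, so the normalization costs nothing in the
    -- recursion.
    have hbD : b j = D j * (‖(charPolynomial A).eval (Q ^ j)‖ * ‖PowerSeries.coeff j ψ‖) := by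
      rw [hDS j hjS]
      simp only [hbdef]
      field_simp
    have hterm : ∀ p ∈ F, D j * (K * B ^ p.degree * PowerSeries.coeff (ν + j)
        (PowerSeries.X ^ (s * p 0) * PowerSeries.mk b' ^ ∑ i : Fin (n + 1), p i.succ)) ≤
        K * target * y * (8 * y) ^ p.degree := by
      intro p _
      set k := ∑ i : Fin (n + 1), p i.succ with hk
      have hdeg : p.degree = p 0 + k := by rw [Finsupp.degree_eq_sum, Fin.sum_univ_succ]
      have hle : p.degree ≤ s * p 0 + k := by
        rw [hdeg]
        have := Nat.le_mul_of_pos_left (p 0) (by omega : 0 < s)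
        omega
      rw [PowerSeries.coeff_X_pow_mul']
      split_ifs with hg
      · have h3 := hmono (s * p 0) k hg
        have hcoeff : 0 ≤ PowerSeries.coeff (ν + j - s * p 0) (PowerSeries.mk b' ^ k) := by
          rw [PowerSeries.coeff_pow]
          refine Finset.sum_nonneg fun l _ => Finset.prod_nonneg fun i _ => ?_
          rw [PowerSeries.coeff_mk]
          exact hb'nn _
        calc D j * (K * B ^ p.degree *
              PowerSeries.coeff (ν + j - s * p 0) (PowerSeries.mk b' ^ k))
            ≤ D j * (K * B ^ (s * p 0 + k) *
              PowerSeries.coeff (ν + j - s * p 0) (PowerSeries.mk b' ^ k)) := by gcongr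
          _ = K * (D j * (B ^ (s * p 0 + k) *
              PowerSeries.coeff (ν + j - s * p 0) (PowerSeries.mk b' ^ k))) := by ring
          _ ≤ K * (target * (y * (8 * y) ^ (s * p 0 + k))) := by gcongr
          _ ≤ K * (target * (y * (8 * y) ^ p.degree)) := by
              have h4 : (8 * y) ^ (s * p 0 + k) ≤ (8 * y) ^ p.degree :=
                pow_le_pow_of_le_one (by positivity) (by linarith) hle
              gcongr
          _ = _ := by ring
      · rw [mul_zero, mul_zero]
        positivity
    calc b j = D j * (‖(charPolynomial A).eval (Q ^ j)‖ * ‖PowerSeries.coeff j ψ‖) := hbD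
      _ ≤ D j * ∑ p ∈ F, K * B ^ p.degree * PowerSeries.coeff (ν + j)
          (PowerSeries.X ^ (s * p 0) * PowerSeries.mk b' ^ ∑ i : Fin (n + 1), p i.succ) := by
        gcongr
      _ ≤ ∑ p ∈ F, K * target * y * (8 * y) ^ p.degree := by
        rw [Finset.mul_sum]
        exact Finset.sum_le_sum hterm
      _ = K * target * y * ∑ p ∈ F, (8 * y) ^ p.degree := by rw [Finset.mul_sum]
      _ ≤ K * target * y * 2 ^ (n + 2) := by
        have h3 := sum_pow_degree_le F (z := 8 * y) (by positivity) (by linarith)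
        gcongr
      _ = target * (K * (y * 2 ^ (n + 2))) := by ring
      _ ≤ target := mul_le_of_le_one_right ht0 hyK
  have hfinal : ∀ j, 1 ≤ j → b j ≤ B₂ * (N * (2 ^ γ * C) ^ j) := by
    intro j hj
    have hj1 : (1 : ℝ) ≤ j := by exact_mod_cast hj
    have h2γ : (1 : ℝ) ≤ 2 ^ γ := one_le_pow₀ (by norm_num)
    have hinv : ((j : ℝ) ^ 2)⁻¹ ≤ 1 := inv_le_one_of_one_le₀ (one_le_pow₀ hj1)
    have hbase : 1 ≤ N * (2 ^ γ * C) ^ j := by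
      have : 1 ≤ (2 ^ γ * C) ^ j := one_le_pow₀ (by nlinarith)
      nlinarith
    rcases Nat.lt_or_ge (2 * ν + 1) j with hjν | hjν
    · have hjpow : (j : ℝ) ^ γ ≤ (2 ^ γ) ^ j := by
        have h3 : (j : ℝ) ≤ 2 ^ j := by exact_mod_cast Nat.lt_two_pow_self.le
        calc (j : ℝ) ^ γ ≤ (2 ^ j) ^ γ := by gcongr
          _ = _ := by rw [← pow_mul, ← pow_mul, mul_comm]
      have h0 := hΛ j hj
      calc b j ≤ Λ j / (j : ℝ) ^ (2 * γ) * ((j : ℝ) ^ 2)⁻¹ * C ^ (j - ν - 1) := hmain j hjν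
        _ ≤ Λ j * 1 * C ^ j := by
            gcongr
            · exact div_le_self h0 (one_le_pow₀ hj1)
            · omega
        _ ≤ (N * (2 ^ γ) ^ j) * 1 * C ^ j := by
            gcongr
            exact (h1 j hj).2.2.trans (by gcongr)
        _ = 1 * (N * (2 ^ γ * C) ^ j) := by rw [mul_pow]; ring
        _ ≤ _ := by gcongr
    · calc b j ≤ B₂ * ((j : ℝ) ^ 2)⁻¹ := hB₂ j hj hjν
        _ ≤ B₂ * (N * (2 ^ γ * C) ^ j) := by
            gcongr
            linarith
  have h2γ : (1 : ℝ) ≤ 2 ^ γ := one_le_pow₀ (by norm_num)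
  have hBN : 1 ≤ B₂ * N := by nlinarith
  have hγC : 1 ≤ 2 ^ γ * C := by nlinarith
  refine ⟨B₂ * N * (2 ^ γ * C), by nlinarith, fun j => ?_⟩
  rcases Nat.eq_zero_or_pos j with rfl | hj
  · rw [hψ, norm_zero, pow_zero]
    exact zero_le_one
  · have h3 := hcb j 0 (Nat.zero_le n)
    rw [pow_zero, norm_one, one_pow, one_mul] at h3
    calc ‖PowerSeries.coeff j ψ‖ ≤ b j := h3
      _ ≤ (B₂ * N) * (2 ^ γ * C) ^ j := by
          rw [mul_assoc]
          exact hfinal j hj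
      _ ≤ (B₂ * N) ^ j * (2 ^ γ * C) ^ j := by
          gcongr
          exact le_self_pow₀ hBN (by omega)
      _ = _ := (mul_pow _ _ _).symm

/-! ### Derivations in the exponents and rationality of the exponents. -/

theorem toExp_add (a b : ℂ) : toExp (a + b) = toExp a + toExp b := rfl

theorem toExp_injective : Function.Injective toExp := by
  intro a b h
  exact Complex.ext (congrArg (fun e => (ofLex e).1) h) (congrArg (fun e => (ofLex e).2) h)

theorem toExp_surjective : Function.Surjective toExp := fun e => ⟨⟨(ofLex e).1, (ofLex e).2⟩, rfl⟩

section EulerDerivation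

/-- The operator `x^e ↦ χ(e) x^e` on Hahn series. -/
noncomputable def eulerOp (χ : ℝ ×ₗ ℝ → ℂ) (g : HahnSeries (ℝ ×ₗ ℝ) ℂ) :
    HahnSeries (ℝ ×ₗ ℝ) ℂ where
  coeff e := χ e * g.coeff e
  isPWO_support' := g.isPWO_support.mono fun _ he => right_ne_zero_of_mul he

variable {χ : ℝ ×ₗ ℝ → ℂ}

theorem coeff_eulerOp (g : HahnSeries (ℝ ×ₗ ℝ) ℂ) (e : ℝ ×ₗ ℝ) :
    (eulerOp χ g).coeff e = χ e * g.coeff e := rfl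

theorem support_eulerOp_subset (g : HahnSeries (ℝ ×ₗ ℝ) ℂ) :
    (eulerOp χ g).support ⊆ g.support := fun _ he => right_ne_zero_of_mul he

theorem eulerOp_add (a b : HahnSeries (ℝ ×ₗ ℝ) ℂ) :
    eulerOp χ (a + b) = eulerOp χ a + eulerOp χ b := by
  ext e
  simp only [coeff_eulerOp, HahnSeries.coeff_add, mul_add]

theorem eulerOp_mul (hχ : ∀ a b, χ (a + b) = χ a + χ b) (a b : HahnSeries (ℝ ×ₗ ℝ) ℂ) :
    eulerOp χ (a * b) = eulerOp χ a * b + a * eulerOp χ b := by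
  ext e
  rw [HahnSeries.coeff_add, coeff_eulerOp, HahnSeries.coeff_mul,
    HahnSeries.coeff_mul_left' a.isPWO_support (support_eulerOp_subset a),
    HahnSeries.coeff_mul_right' b.isPWO_support (support_eulerOp_subset b),
    ← Finset.sum_add_distrib, Finset.mul_sum]
  refine Finset.sum_congr rfl fun p hp => ?_
  have h1 : p.1 + p.2 = e := (Finset.mem_antidiagonal.1 hp).2.2
  rw [coeff_eulerOp, coeff_eulerOp, ← h1, hχ]
  ring

theorem eulerOp_single (c : ℂ) (e : ℝ ×ₗ ℝ) (h : χ e = 0) :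
    eulerOp χ (HahnSeries.single e c) = 0 := by
  ext e'
  rw [coeff_eulerOp, HahnSeries.coeff_zero]
  by_cases he : e' = e
  · rw [he, h, zero_mul]
  · rw [HahnSeries.coeff_single_of_ne he, mul_zero]

end EulerDerivation

namespace GenPowerSeries

/-- The Hahn series `x, φ, σφ, …, σⁿφ`. -/
noncomputable def hahnTuple (lnq : ℂ) (φ : GenPowerSeries) (n : ℕ) :
    Fin (n + 2) → HahnSeries (ℝ ×ₗ ℝ) ℂ :=
  Fin.cons (HahnSeries.single (toExp 1) 1) fun j : Fin (n + 1) => ((sigma lnq)^[(j : ℕ)] φ).toHahn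

theorem monomialValue_eq_prod (lnq : ℂ) (φ : GenPowerSeries) {n : ℕ} (p : Fin (n + 2) →₀ ℕ) :
    monomialValue lnq φ p = ∏ i, hahnTuple lnq φ n i ^ p i := by
  rw [Fin.prod_univ_succ]
  rfl

theorem exists_reGe_hahnTuple (lnq : ℂ) (φ : GenPowerSeries) (n : ℕ) :
    ∃ m : ℝ, 0 < m ∧ ∀ i, ReGe m (hahnTuple lnq φ n i) := by
  refine ⟨min 1 (φ.expo 0).re, lt_min one_pos (φ.re_pos 0), fun i => ?_⟩
  refine Fin.cases ?_ (fun j => ?_) i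
  · intro e he
    by_cases h : e = toExp 1
    · subst h
      exact min_le_left 1 (φ.expo 0).re
    · exact absurd (HahnSeries.coeff_single_of_ne h) he
  · intro e he
    have h := reGe_toHahn ((sigma lnq)^[(j : ℕ)] φ) e he
    rw [sigma_iterate_expo] at h
    exact (min_le_right _ _).trans h

/-- The coefficients `substCoeff` in a half-plane of exponents are those of the value of a
sufficiently long truncation. -/
theorem exists_substCoeff_eq (lnq : ℂ) (φ : GenPowerSeries) (n : ℕ) (a : ℝ) :
    ∃ N₀ : ℕ, ∀ N ≥ N₀, ∀ (f : MvPowerSeries (Fin (n + 2)) ℂ) (μ : ℂ), μ.re ≤ a →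
      φ.substCoeff lnq f μ = (MvPolynomial.aeval (hahnTuple lnq φ n)
        (MvPowerSeries.truncTotal N f)).coeff (toExp μ) := by
  obtain ⟨m, hm, hY⟩ := exists_reGe_hahnTuple lnq φ n
  obtain ⟨N₀, hN₀⟩ := exists_nat_gt (a / m)
  refine ⟨N₀, fun N hN f μ hμ => ?_⟩
  let c : HahnSeries (ℝ ×ₗ ℝ) ℂ →ₗ[ℂ] ℂ :=
    { toFun := fun g => g.coeff (toExp μ)
      map_add' := fun _ _ => HahnSeries.coeff_add
      map_smul' := fun _ _ => HahnSeries.coeff_smul }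
  have h := MvPowerSeries.finsum_coeff_mul_eq_aeval c (hahnTuple lnq φ n) N ?_ f
  · rw [substCoeff]
    simp only [monomialValue_eq_prod]
    exact h
  · intro p hp
    by_contra hne
    have h1 := ReGe.prod Finset.univ (fun i => (p i : ℝ) * m) _
      (fun i _ => (hY i).pow (p i)) (toExp μ) hne
    rw [← Finset.sum_mul] at h1
    have h2 : (N₀ : ℝ) ≤ ∑ i, (p i : ℝ) := by
      rw [Finsupp.degree_eq_sum] at hp
      exact_mod_cast hN.le.trans hp
    have h3 : μ.re = (ofLex (toExp μ)).1 := rfl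
    rw [← h3] at h1
    rw [div_lt_iff₀ hm] at hN₀
    nlinarith

theorem sigma_iterate_coeff (lnq : ℂ) (φ : GenPowerSeries) (j k : ℕ) :
    ((sigma lnq)^[j] φ).coeff k = Complex.exp (φ.expo k * lnq) ^ j * φ.coeff k := by
  induction j with
  | zero => simp
  | succ j ih =>
    rw [Function.iterate_succ_apply']
    change Complex.exp (((sigma lnq)^[j] φ).expo k * lnq) * ((sigma lnq)^[j] φ).coeff k = _
    rw [ih, sigma_iterate_expo]
    ring

theorem coeff_toHahn_sigma_iterate (lnq : ℂ) (φ : GenPowerSeries) (j k : ℕ) :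
    ((sigma lnq)^[j] φ).toHahn.coeff (toExp (φ.expo k)) =
      Complex.exp (φ.expo k * lnq) ^ j * φ.coeff k := by
  have h := coeff_toHahn ((sigma lnq)^[j] φ) k
  rw [sigma_iterate_expo] at h
  rw [h, sigma_iterate_coeff]

theorem exists_of_coeff_toHahn_sigma_iterate_ne_zero {lnq : ℂ} {φ : GenPowerSeries} {j : ℕ}
    {e : ℝ ×ₗ ℝ} (h : ((sigma lnq)^[j] φ).toHahn.coeff e ≠ 0) :
    ∃ k, e = toExp (φ.expo k) ∧ φ.coeff k ≠ 0 := by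
  by_cases hmem : e ∈ Set.range fun k => toExp (((sigma lnq)^[j] φ).expo k)
  · obtain ⟨k, rfl⟩ := hmem
    simp only [sigma_iterate_expo] at h ⊢
    refine ⟨k, rfl, fun h0 => h ?_⟩
    rw [coeff_toHahn_sigma_iterate, h0, mul_zero]
  · exact absurd (coeff_eq_zero_of_notMem _ hmem) h

/-- If the linearization along a formal solution has no resonances with the exponents of the
solution, then these exponents are rational: otherwise a derivation with respect to the exponents
produces a formal solution of the linearized equation. -/
theorem exists_rat_expo {n : ℕ} {lnq : ℂ} {f : MvPowerSeries (Fin (n + 2)) ℂ}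
    {φ : GenPowerSeries} (hsol : φ.IsFormalSolution lnq f) {ν : ℂ} {A : Fin (n + 1) → ℂ}
    (hA : ∀ j : Fin (n + 1),
      HasForm (φ.substCoeff lnq (MvPowerSeries.pderiv ℂ j.succ f)) (A j) ν)
    (hL : ∀ k, φ.coeff k ≠ 0 → (charPolynomial A).eval (Complex.exp (φ.expo k * lnq)) ≠ 0)
    (k : ℕ) (hk : φ.coeff k ≠ 0) : ∃ r : ℚ, φ.expo k = r := by
  classical
  by_contra hrat
  obtain ⟨χ, hχk, hχ1⟩ : ∃ χ : ℂ →ₗ[ℚ] ℚ, χ (φ.expo k) ≠ 0 ∧ χ 1 = 0 := by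
    have hnot : φ.expo k ∉ Submodule.span ℚ {(1 : ℂ)} := by
      intro hmem
      obtain ⟨r, hr⟩ := Submodule.mem_span_singleton.1 hmem
      exact hrat ⟨r, by rw [← hr, Rat.smul_def, mul_one]⟩
    obtain ⟨χ, h1, h2⟩ := Submodule.exists_le_ker_of_notMem hnot
    exact ⟨χ, h1, h2 (Submodule.mem_span_singleton_self _)⟩
  have hex : ∃ k, φ.coeff k ≠ 0 ∧ χ (φ.expo k) ≠ 0 := ⟨k, hk, hχk⟩
  obtain ⟨hk₀, hχ₀⟩ := Nat.find_spec hex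
  set k₀ := Nat.find hex with hk₀def
  have hmin : ∀ k, φ.coeff k ≠ 0 → χ (φ.expo k) ≠ 0 → (φ.expo k₀).re ≤ (φ.expo k).re :=
    fun k h1 h2 => φ.re_mono (Nat.find_min' hex ⟨h1, h2⟩)
  set lam := φ.expo k₀ with hlam
  let X : ℝ ×ₗ ℝ → ℂ := fun e => (χ ⟨(ofLex e).1, (ofLex e).2⟩ : ℚ)
  have hXexp : ∀ z : ℂ, X (toExp z) = (χ z : ℚ) := fun z => rfl
  have hX : ∀ a b, X (a + b) = X a + X b := by
    intro a b
    obtain ⟨a, rfl⟩ := toExp_surjective a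
    obtain ⟨b, rfl⟩ := toExp_surjective b
    rw [← toExp_add, hXexp, hXexp, hXexp, map_add, Rat.cast_add]
  have hX0 : X 0 = 0 := by
    have := hX 0 0
    rw [add_zero] at this
    simpa using this
  obtain ⟨N₀, hN₀⟩ := exists_substCoeff_eq lnq φ n (ν.re + lam.re)
  set Y := hahnTuple lnq φ n with hY
  -- The extra degree is lost under `pderiv`, which leaves truncations of order `N₀` of the
  -- derivatives.
  set P := MvPowerSeries.truncTotal (N₀ + 1) f with hP
  have hchain := MvPolynomial.derivation_aeval (eulerOp X) eulerOp_add (eulerOp_mul hX)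
    (fun c => by
      rw [HahnSeries.algebraMap_apply, HahnSeries.C_apply]
      exact eulerOp_single _ _ hX0) Y P
  have hcoeff := congrArg (fun g => g.coeff (toExp (ν + lam))) hchain
  rw [coeff_eulerOp, ← hN₀ (N₀ + 1) (by omega) f (ν + lam) (by simp), hsol, mul_zero,
    Fin.sum_univ_succ, HahnSeries.coeff_add, HahnSeries.coeff_sum] at hcoeff
  have hY0 : eulerOp X (Y 0) = 0 := by
    refine eulerOp_single _ _ ?_
    rw [hXexp, hχ1, Rat.cast_zero]
  have hterm : ∀ j : Fin (n + 1),
      (MvPolynomial.aeval Y (MvPolynomial.pderiv j.succ P) * eulerOp X (Y j.succ)).coeff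
        (toExp (ν + lam)) =
      A j * Complex.exp (lam * lnq) ^ (j : ℕ) * ((χ lam : ℚ) * φ.coeff k₀) := by
    intro j
    have hG : ∀ μ : ℂ, μ.re ≤ ν.re →
        (MvPolynomial.aeval Y (MvPolynomial.pderiv j.succ P)).coeff (toExp μ) =
          if μ = ν then A j else 0 := by
      intro μ hμ
      rw [hP, ← MvPowerSeries.truncTotal_pderiv, hY, ← hN₀ N₀ le_rfl _ μ
        (by have := φ.re_pos k₀; linarith)]
      split_ifs with h
      · rw [h, (hA j).1]
      · exact (hA j).2 μ h hμ
    have hYj : Y j.succ = ((sigma lnq)^[(j : ℕ)] φ).toHahn := rfl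
    have hpair : (MvPolynomial.aeval Y (MvPolynomial.pderiv j.succ P)).coeff (toExp ν) *
        (eulerOp X (Y j.succ)).coeff (toExp lam) =
        A j * Complex.exp (lam * lnq) ^ (j : ℕ) * ((χ lam : ℚ) * φ.coeff k₀) := by
      rw [hG ν le_rfl, if_pos rfl, coeff_eulerOp, hXexp, hYj, hlam, coeff_toHahn_sigma_iterate]
      ring
    rw [← hpair, HahnSeries.coeff_mul]
    refine Finset.sum_eq_single (toExp ν, toExp lam) ?_ ?_
    · rintro ⟨a, b⟩ hab hne
      obtain ⟨-, hb, hsum⟩ := Finset.mem_antidiagonal.1 hab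
      obtain ⟨a, rfl⟩ := toExp_surjective a
      simp only at hb hsum ⊢
      rw [HahnSeries.mem_support, coeff_eulerOp, hYj] at hb
      obtain ⟨i, rfl, hi⟩ :=
        exists_of_coeff_toHahn_sigma_iterate_ne_zero (right_ne_zero_of_mul hb)
      have hχi : χ (φ.expo i) ≠ 0 := by
        intro h0
        apply left_ne_zero_of_mul hb
        rw [hXexp, h0, Rat.cast_zero]
      have hre := hmin i hi hχi
      rw [← toExp_add] at hsum
      have hsum' : a + φ.expo i = ν + lam := toExp_injective hsum
      have hare : a.re + (φ.expo i).re = ν.re + lam.re := by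
        have := congrArg Complex.re hsum'
        simpa using this
      -- Minimality of `Re lam` forces `Re a ≤ Re ν`, where the partial derivative has only the
      -- exponent `ν`. Other exponents with the same real part as `lam` therefore do no harm.
      rw [hG a (by linarith), if_neg, zero_mul]
      rintro rfl
      exact hne (by rw [add_left_cancel hsum'])
    · intro hnot
      by_contra hne
      exact hnot (Finset.mem_antidiagonal.2 ⟨left_ne_zero_of_mul hne, right_ne_zero_of_mul hne,
        (toExp_add _ _).symm⟩)
  rw [hY0, mul_zero, HahnSeries.coeff_zero, zero_add, Finset.sum_congr rfl fun j _ => hterm j,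
    ← Finset.sum_mul, ← eval_charPolynomial] at hcoeff
  have h1 := hL k₀ hk₀
  have h2 : ((χ lam : ℚ) : ℂ) ≠ 0 := by exact_mod_cast hχ₀
  exact mul_ne_zero h1 (mul_ne_zero h2 hk₀) hcoeff.symm

end GenPowerSeries

/-! ### Passage to power series in `x^(1/s)`. -/

section Ramification

/-- The exponents `j / s`. -/
noncomputable def ramifiedExp (s : ℕ) : ℕ →+ ℝ ×ₗ ℝ where
  toFun j := toExp (j / s)
  map_zero' := by
    rw [Nat.cast_zero, zero_div]
    rfl
  map_add' a b := by rw [Nat.cast_add, add_div, toExp_add]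

theorem ramifiedExp_injective {s : ℕ} (hs : 1 ≤ s) : Function.Injective (ramifiedExp s) := by
  intro a b h
  have hs0 : (s : ℂ) ≠ 0 := by exact_mod_cast (by omega : s ≠ 0)
  have h1 := toExp_injective h
  rw [div_left_inj' hs0] at h1
  exact_mod_cast h1

theorem ramifiedExp_le_iff {s : ℕ} (hs : 1 ≤ s) (a b : ℕ) :
    ramifiedExp s a ≤ ramifiedExp s b ↔ a ≤ b := by
  have hs0 : (0 : ℝ) < s := by exact_mod_cast hs
  have hre : ∀ c : ℕ, (ofLex (ramifiedExp s c)).1 = (c : ℝ) / s := fun c => by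
    change ((c : ℂ) / s).re = _
    rw [← Complex.ofReal_natCast, ← Complex.ofReal_natCast, ← Complex.ofReal_div,
      Complex.ofReal_re]
  have hmono : Monotone fun c : ℕ => ramifiedExp s c := by
    refine monotone_nat_of_le_succ fun c => le_of_lt ((Prod.Lex.lt_iff).2 (Or.inl ?_))
    rw [hre, hre]
    gcongr
    omega
  exact (hmono.strictMono_of_injective (ramifiedExp_injective hs)).le_iff_le

/-- Substitution of `x^{1/s}` for the variable of a power series. -/
noncomputable def ramify {s : ℕ} (hs : 1 ≤ s) : PowerSeries ℂ →+* HahnSeries (ℝ ×ₗ ℝ) ℂ :=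
  (HahnSeries.embDomainRingHom (ramifiedExp s) (ramifiedExp_injective hs)
    (ramifiedExp_le_iff hs)).comp
    (HahnSeries.toPowerSeries (R := ℂ)).symm.toRingHom

theorem coeff_ramify {s : ℕ} (hs : 1 ≤ s) (g : PowerSeries ℂ) (j : ℕ) :
    (ramify hs g).coeff (toExp (j / s)) = PowerSeries.coeff j g := by
  have h := HahnSeries.embDomain_coeff (f := ⟨⟨ramifiedExp s, ramifiedExp_injective hs⟩,
    ramifiedExp_le_iff hs _ _⟩) (x := (HahnSeries.toPowerSeries (R := ℂ)).symm g) (a := j)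
  exact h

theorem coeff_ramify_eq_zero {s : ℕ} (hs : 1 ≤ s) (g : PowerSeries ℂ) {e : ℝ ×ₗ ℝ}
    (he : ∀ j : ℕ, e ≠ toExp (j / s)) : (ramify hs g).coeff e = 0 := by
  refine HahnSeries.embDomain_of_notMem_range ?_
  rintro ⟨j, rfl⟩
  exact he j rfl

theorem ramify_X_pow {s : ℕ} (hs : 1 ≤ s) : ramify hs (PowerSeries.X ^ s) = HahnSeries.single (toExp 1) 1 := by
  have hs0 : (s : ℂ) ≠ 0 := by exact_mod_cast (by omega : s ≠ 0)
  ext e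
  by_cases he : ∃ j : ℕ, e = toExp (j / s)
  · obtain ⟨j, rfl⟩ := he
    rw [coeff_ramify, PowerSeries.coeff_X_pow]
    split_ifs with hj
    · rw [hj, div_self hs0, HahnSeries.coeff_single_same]
    · rw [HahnSeries.coeff_single_of_ne]
      intro h
      have h1 := toExp_injective h
      rw [div_eq_one_iff_eq hs0] at h1
      exact hj (by exact_mod_cast h1)
  · push Not at he
    rw [coeff_ramify_eq_zero hs _ he, HahnSeries.coeff_single_of_ne]
    intro h
    apply he s
    rw [div_self hs0]
    exact h

namespace GenPowerSeries

/-- The power series in `x^{1/s}` given by the terms of `φ` with exponents `j / s`. -/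
noncomputable def toRamified (s : ℕ) (φ : GenPowerSeries) : PowerSeries ℂ :=
  PowerSeries.mk fun j => φ.toHahn.coeff (toExp (j / s))

theorem toHahn_sigma_iterate_eq_ramify {s : ℕ} (hs : 1 ≤ s) {φ : GenPowerSeries}
    (hφ : ∀ k, φ.coeff k ≠ 0 → ∃ j : ℕ, φ.expo k = j / s)
    (lnq : ℂ) (i : ℕ) :
    ((sigma lnq)^[i] φ).toHahn =
      ramify hs (PowerSeries.rescale (Complex.exp (lnq / s) ^ i) (φ.toRamified s)) := by
  ext e
  by_cases he : ∃ j : ℕ, e = toExp (j / s)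
  · obtain ⟨j, rfl⟩ := he
    rw [coeff_ramify, PowerSeries.coeff_rescale, toRamified, PowerSeries.coeff_mk]
    by_cases h : ∃ k, toExp (φ.expo k) = toExp (j / s)
    · obtain ⟨k, hk⟩ := h
      rw [← hk, coeff_toHahn_sigma_iterate, coeff_toHahn, toExp_injective hk, ← pow_mul, mul_comm i,
        pow_mul, ← Complex.exp_nat_mul (lnq / s)]
      congr 3
      ring
    · have h0 : ∀ i, ((sigma lnq)^[i] φ).toHahn.coeff (toExp (j / s)) = 0 := by
        intro i
        by_contra hne
        obtain ⟨k, hk, -⟩ := exists_of_coeff_toHahn_sigma_iterate_ne_zero hne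
        exact h ⟨k, hk.symm⟩
      have h1 := h0 0
      rw [Function.iterate_zero, id] at h1
      rw [h0, h1, mul_zero]
  · push Not at he
    rw [coeff_ramify_eq_zero hs _ he]
    by_contra hne
    obtain ⟨k, rfl, hk⟩ := exists_of_coeff_toHahn_sigma_iterate_ne_zero hne
    obtain ⟨j, hj⟩ := hφ k hk
    exact he j (by rw [hj])

theorem monomialValue_eq_ramify {s : ℕ} (hs : 1 ≤ s) {φ : GenPowerSeries}
    (hφ : ∀ k, φ.coeff k ≠ 0 → ∃ j : ℕ, φ.expo k = j / s)
    (lnq : ℂ) {n : ℕ} (p : Fin (n + 2) →₀ ℕ) :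
    monomialValue lnq φ p = ramify hs
      (∏ i, shiftTuple n s (Complex.exp (lnq / s)) (φ.toRamified s) i ^ p i) := by
  rw [map_prod, monomialValue_eq_prod]
  refine Finset.prod_congr rfl fun i _ => ?_
  rw [map_pow]
  congr 1
  refine Fin.cases ?_ (fun i => ?_) i
  · exact (ramify_X_pow hs).symm
  · exact toHahn_sigma_iterate_eq_ramify hs hφ lnq i

theorem substCoeff_eq_finsum {s : ℕ} (hs : 1 ≤ s) {φ : GenPowerSeries}
    (hφ : ∀ k, φ.coeff k ≠ 0 → ∃ j : ℕ, φ.expo k = j / s)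
    (lnq : ℂ) {n : ℕ} (f : MvPowerSeries (Fin (n + 2)) ℂ) (j : ℕ) :
    φ.substCoeff lnq f (j / s) = ∑ᶠ p : Fin (n + 2) →₀ ℕ, MvPowerSeries.coeff p f *
      PowerSeries.coeff j
        (∏ i, shiftTuple n s (Complex.exp (lnq / s)) (φ.toRamified s) i ^ p i) := by
  rw [substCoeff]
  simp only [monomialValue_eq_ramify hs hφ, coeff_ramify]

/-- Used to show that `ν` is itself a nonnegative multiple of `1/s`. -/
theorem exists_eq_div_of_substCoeff_ne_zero {s : ℕ} (hs : 1 ≤ s) {φ : GenPowerSeries}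
    (hφ : ∀ k, φ.coeff k ≠ 0 → ∃ j : ℕ, φ.expo k = j / s)
    {lnq : ℂ} {n : ℕ}
    {f : MvPowerSeries (Fin (n + 2)) ℂ} {μ : ℂ} (h : φ.substCoeff lnq f μ ≠ 0) :
    ∃ j : ℕ, μ = j / s := by
  by_contra! hne
  apply h
  rw [substCoeff]
  refine finsum_eq_zero_of_forall_eq_zero fun p => ?_
  rw [monomialValue_eq_ramify hs hφ, coeff_ramify_eq_zero, mul_zero]
  exact fun j hj => hne j (toExp_injective hj)

end GenPowerSeries

end Ramification

/-! ### Cauchy estimates for the Taylor coefficients. -/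

theorem HasTaylorSeriesAtZero.exists_norm_coeff_le {m : ℕ} {F : (Fin m → ℂ) → ℂ}
    {f : MvPowerSeries (Fin m) ℂ} (hF : HasTaylorSeriesAtZero F f) :
    ∃ K B : ℝ, 0 ≤ K ∧ 1 ≤ B ∧ ∀ p, ‖MvPowerSeries.coeff p f‖ ≤ K * B ^ p.degree := by
  obtain ⟨ε, hε, hball⟩ := Metric.eventually_nhds_iff.1 hF
  set r : ℝ := min (ε / 2) 1 with hr
  have hr0 : 0 < r := by positivity
  have hr1 : r ≤ 1 := min_le_right _ _
  have hnorm : ‖(r : ℂ)‖ = r := by rw [Complex.norm_real, Real.norm_of_nonneg hr0.le]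
  have hdist : dist (fun _ : Fin m => (r : ℂ)) 0 < ε := by
    rw [dist_zero_right]
    refine ((pi_norm_le_iff_of_nonneg hr0.le).2 fun i => hnorm.le).trans_lt ?_
    exact (min_le_left _ _).trans_lt (by linarith)
  have hsum := (hball hdist).summable.norm
  have hterm : ∀ p : Fin m →₀ ℕ, ‖MvPowerSeries.coeff p f * ∏ i, (r : ℂ) ^ p i‖ =
      ‖MvPowerSeries.coeff p f‖ * r ^ p.degree := fun p => by
    rw [norm_mul, Finset.prod_pow_eq_pow_sum, norm_pow, hnorm, Finsupp.degree_eq_sum]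
  refine ⟨∑' p : Fin m →₀ ℕ, ‖MvPowerSeries.coeff p f * ∏ i, (r : ℂ) ^ p i‖, 1 / r,
    tsum_nonneg fun _ => norm_nonneg _, (one_le_div hr0).2 hr1, fun p => ?_⟩
  have h := hsum.le_tsum p fun _ _ => norm_nonneg _
  rw [hterm] at h
  rw [one_div, inv_pow, ← div_eq_mul_inv, le_div_iff₀ (by positivity)]
  exact h

/-! ### Rational elements of the exponent semigroup. -/

section Semigroup

variable {τ : ℕ} {ρ : Fin τ → ℂ}

theorem re_sum_pos (hρ : ∀ i, 0 < (ρ i).re) {m : Fin τ → ℕ} (hm : m ≠ 0) :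
    0 < (∑ i, (m i : ℂ) * ρ i).re := by
  obtain ⟨i, hi⟩ := Function.ne_iff.1 hm
  have hre : ∀ i, ((m i : ℂ) * ρ i).re = m i * (ρ i).re := fun i => by
    rw [← Complex.ofReal_natCast, Complex.re_ofReal_mul]
  rw [Complex.re_sum]
  refine Finset.sum_pos' (fun i _ => ?_) ⟨i, Finset.mem_univ i, ?_⟩
  · rw [hre]
    exact mul_nonneg (Nat.cast_nonneg _) (hρ i).le
  · rw [hre]
    exact mul_pos (Nat.cast_pos.2 (Nat.pos_of_ne_zero hi)) (hρ i)

/-- Rational elements of a semigroup with independent generators are proportional to each other,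
together with their coordinates. -/
theorem mul_coord_eq_mul_coord (hind : LinearIndependent ℤ ρ) {r r' : ℚ} {m m' : Fin τ → ℕ}
    (h : (r : ℂ) = ∑ i, (m i : ℂ) * ρ i) (h' : (r' : ℂ) = ∑ i, (m' i : ℂ) * ρ i) (i : Fin τ) :
    r * m' i = r' * m i := by
  have hq : LinearIndependent ℚ ρ := (LinearIndependent.iff_fractionRing ℤ ℚ).1 hind
  have hzero : ∑ i, (r * m' i - r' * m i) • ρ i = 0 := by
    have hterm : ∀ i, (r * m' i - r' * m i) • ρ i =
        (r : ℂ) * ((m' i : ℂ) * ρ i) - (r' : ℂ) * ((m i : ℂ) * ρ i) := fun i => by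
      rw [Rat.smul_def]
      push_cast
      ring
    simp only [hterm]
    rw [Finset.sum_sub_distrib, ← Finset.mul_sum, ← Finset.mul_sum, ← h, ← h']
    ring
  exact sub_eq_zero.1 (Fintype.linearIndependent_iff.1 hq _ hzero i)

/-- All coordinate vectors lie on one ray: `r = r₀ m_i / m₀_i` for a fixed element `r₀` and a fixed
coordinate with `m₀_i ≠ 0`, so the denominator of `r₀` times `m₀_i` works for every `r`. -/
theorem exists_common_denominator (hρ : ∀ i, 0 < (ρ i).re) (hind : LinearIndependent ℤ ρ)
    {T : Set ℂ} (hT : ∀ z ∈ T, ∃ r : ℚ, z = r)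
    (hTρ : ∀ z ∈ T, ∃ m : Fin τ → ℕ, m ≠ 0 ∧ z = ∑ i, (m i : ℂ) * ρ i) :
    ∃ s : ℕ, 1 ≤ s ∧ ∀ z ∈ T, ∃ j : ℕ, z = j / s := by
  rcases T.eq_empty_or_nonempty with rfl | ⟨z₀, hz₀⟩
  · exact ⟨1, le_rfl, fun z hz => hz.elim⟩
  obtain ⟨r₀, hr₀⟩ := hT z₀ hz₀
  obtain ⟨m₀, hm₀, hz₀m⟩ := hTρ z₀ hz₀
  obtain ⟨i, hi⟩ := Function.ne_iff.1 hm₀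
  have hi0 : m₀ i ≠ 0 := hi
  have hr₀pos : 0 < r₀ := by
    have h := re_sum_pos hρ hm₀
    rw [← hz₀m, hr₀, Complex.ratCast_re] at h
    exact_mod_cast h
  refine ⟨r₀.den * m₀ i, Nat.mul_pos r₀.den_pos (Nat.pos_of_ne_zero hi0), fun z hz => ?_⟩
  obtain ⟨r, hr⟩ := hT z hz
  obtain ⟨m, hm, hzm⟩ := hTρ z hz
  have hprop := mul_coord_eq_mul_coord hind (hr₀.symm.trans hz₀m) (hr.symm.trans hzm) i
  refine ⟨r₀.num.toNat * m i, ?_⟩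
  have hnum : ((r₀.num.toNat : ℕ) : ℚ) = r₀.den * r₀ := by
    have h1 : ((r₀.num.toNat : ℕ) : ℤ) = r₀.num := Int.toNat_of_nonneg (Rat.num_pos.2 hr₀pos).le
    have h2 : ((r₀.num.toNat : ℕ) : ℚ) = (r₀.num : ℚ) := by exact_mod_cast h1
    rw [h2, Rat.den_mul_eq_num]
  have hden : (r₀.den : ℚ) ≠ 0 := Nat.cast_ne_zero.2 r₀.den_pos.ne'
  have hmi : (m₀ i : ℚ) ≠ 0 := Nat.cast_ne_zero.2 hi0
  have hkey : r = ((r₀.num.toNat * m i : ℕ) : ℚ) / ((r₀.den * m₀ i : ℕ) : ℚ) := by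
    rw [eq_div_iff (by push_cast; exact mul_ne_zero hden hmi)]
    push_cast
    rw [hnum]
    linear_combination -(r₀.den : ℚ) * hprop
  rw [hr, hkey]
  push_cast
  rfl

/-- The numbers `j` such that `j / s` lies in the semigroup generated by `ρ`. -/
def ramifiedSemigroup (ρ : Fin τ → ℂ) (s : ℕ) : Set ℕ :=
  {j | ∃ m : Fin τ → ℕ, m ≠ 0 ∧ (j : ℂ) / s = ∑ i, (m i : ℂ) * ρ i}

theorem pos_of_mem_ramifiedSemigroup (hρ : ∀ i, 0 < (ρ i).re) {s j : ℕ}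
    (hj : j ∈ ramifiedSemigroup ρ s) : 1 ≤ j := by
  obtain ⟨m, hm, h⟩ := hj
  have hpos := re_sum_pos hρ hm
  rw [← h] at hpos
  refine Nat.one_le_iff_ne_zero.2 ?_
  rintro rfl
  simp at hpos

/-- Coordinates of `i / s` and `j / s` are in the ratio `i : j`, so those of the smaller number can
be subtracted within the natural numbers. -/
theorem sub_mem_ramifiedSemigroup (hρ : ∀ i, 0 < (ρ i).re) (hind : LinearIndependent ℤ ρ) {s : ℕ}
    (hs : 1 ≤ s) {i j : ℕ} (hi : i ∈ ramifiedSemigroup ρ s) (hj : j ∈ ramifiedSemigroup ρ s)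
    (hij : i < j) : j - i ∈ ramifiedSemigroup ρ s := by
  have hi1 := pos_of_mem_ramifiedSemigroup hρ hi
  obtain ⟨m, hm, hmi⟩ := hi
  obtain ⟨m', hm', hmj⟩ := hj
  have hs0 : (s : ℚ) ≠ 0 := by exact_mod_cast (by omega : s ≠ 0)
  have hs0' : (s : ℂ) ≠ 0 := by exact_mod_cast (by omega : s ≠ 0)
  have hle : ∀ t, m t ≤ m' t := fun t => by
    have h := mul_coord_eq_mul_coord hind (r := (i : ℚ) / s) (r' := (j : ℚ) / s)
      (by push_cast; exact hmi) (by push_cast; exact hmj) t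
    rw [div_mul_eq_mul_div, div_mul_eq_mul_div, div_left_inj' hs0] at h
    have h2 : i * m' t = j * m t := by exact_mod_cast h
    have h3 : i * m t ≤ i * m' t := h2 ▸ Nat.mul_le_mul_right _ hij.le
    exact le_of_mul_le_mul_left h3 hi1
  have hsum : ((j - i : ℕ) : ℂ) / s = ∑ t, (((m' - m) t : ℕ) : ℂ) * ρ t := by
    rw [Nat.cast_sub hij.le, sub_div, hmi, hmj, ← Finset.sum_sub_distrib]
    refine Finset.sum_congr rfl fun t _ => ?_
    rw [Pi.sub_apply, Nat.cast_sub (hle t), sub_mul]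
  refine ⟨m' - m, fun h0 => ?_, hsum⟩
  rw [h0] at hsum
  simp only [Pi.zero_apply, Nat.cast_zero, zero_mul, Finset.sum_const_zero, div_eq_zero_iff,
    hs0', or_false, Nat.cast_eq_zero] at hsum
  omega

/-- Taking real parts of `j / s = ∑ m_i ρ_i` bounds `∑ m_i` by a multiple of `j`, so a power of `∑
m_i` may be replaced by a power of `j`. -/
theorem logDiophantine_ramifiedSemigroup (hρ : ∀ i, 0 < (ρ i).re) {s : ℕ} (hs : 1 ≤ s)
    {l a : ℂ} {c γ : ℝ} (hc : 0 < c)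
    (h : ∀ m : Fin τ → ℕ, m ≠ 0 → ∀ k : ℤ, c * (∑ i, (m i : ℝ)) ^ (-γ) <
      ‖(∑ i, (m i : ℂ) * ρ i) * l - Complex.log a - 2 * Real.pi * k * Complex.I‖) :
    LogDiophantine (ramifiedSemigroup ρ s) (l / s) a := by
  set M : ℝ := max 1 (∑ i, ((ρ i).re)⁻¹) with hM
  have hM1 : 1 ≤ M := le_max_left _ _
  refine ⟨c / M ^ ⌈γ⌉₊, ⌈γ⌉₊, by positivity, ?_⟩
  rintro j ⟨m, hm, hmj⟩ hj1 k
  have hj1' : (1 : ℝ) ≤ j := by exact_mod_cast hj1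
  have hs1 : (1 : ℝ) ≤ s := by exact_mod_cast hs
  have hre : ∑ i, (m i : ℝ) * (ρ i).re = (j : ℝ) / s := by
    have h1 := congrArg Complex.re hmj
    rw [Complex.re_sum, ← Complex.ofReal_natCast, ← Complex.ofReal_natCast, ← Complex.ofReal_div,
      Complex.ofReal_re] at h1
    rw [h1]
    refine Finset.sum_congr rfl fun i _ => ?_
    rw [← Complex.ofReal_natCast, Complex.re_ofReal_mul]
  have hle : ∑ i, (m i : ℝ) ≤ M * j := by
    calc ∑ i, (m i : ℝ) ≤ ∑ i, ((ρ i).re)⁻¹ * ((j : ℝ) / s) := by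
          refine Finset.sum_le_sum fun i _ => ?_
          rw [← hre, inv_mul_eq_div, le_div_iff₀ (hρ i)]
          exact Finset.single_le_sum (f := fun i => (m i : ℝ) * (ρ i).re)
            (fun i _ => mul_nonneg (Nat.cast_nonneg _) (hρ i).le) (Finset.mem_univ i)
      _ = (∑ i, ((ρ i).re)⁻¹) * ((j : ℝ) / s) := by rw [Finset.sum_mul]
      _ ≤ M * j := by
          refine mul_le_mul (le_max_right _ _) (div_le_self (by positivity) hs1) (by positivity)
            (by positivity)
  have hone : (1 : ℝ) ≤ ∑ i, (m i : ℝ) := by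
    obtain ⟨i, hi⟩ := Function.ne_iff.1 hm
    have h1 : (1 : ℝ) ≤ m i := by exact_mod_cast Nat.one_le_iff_ne_zero.2 hi
    exact h1.trans (Finset.single_le_sum (f := fun i => (m i : ℝ))
      (fun i _ => Nat.cast_nonneg _) (Finset.mem_univ i))
  have hrw : (j : ℂ) * (l / s) = (∑ i, (m i : ℂ) * ρ i) * l := by
    rw [← hmj]
    ring
  rw [hrw]
  refine lt_of_le_of_lt ?_ (h m hm k)
  rw [div_div, ← mul_pow, div_eq_mul_inv]
  refine mul_le_mul_of_nonneg_left ?_ hc.le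
  calc ((M * j) ^ ⌈γ⌉₊)⁻¹ ≤ ((∑ i, (m i : ℝ)) ^ ⌈γ⌉₊)⁻¹ := by gcongr
    _ = (∑ i, (m i : ℝ)) ^ (-(⌈γ⌉₊ : ℝ)) := by
        rw [Real.rpow_neg (by positivity), Real.rpow_natCast]
    _ ≤ (∑ i, (m i : ℝ)) ^ (-γ) :=
        Real.rpow_le_rpow_of_exponent_le hone (neg_le_neg (Nat.le_ceil γ))

end Semigroup

/-! ### Uniform convergence in sectors. -/

namespace GenPowerSeries

/-- Since the exponents are real, `|x^(j/s)| = |x|^(j/s)` for every branch. For `|x| < (2C)^(-s)`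
the terms are at most `2^(-j)`, and distinct exponents give distinct `j`. -/
theorem exists_tendstoUniformlyOn_partialSum {φ : GenPowerSeries} {s : ℕ} (hs : 1 ≤ s) {C : ℝ}
    (hC : 1 ≤ C)
    (hφ : ∀ k, φ.coeff k ≠ 0 → ∃ j : ℕ, φ.expo k = j / s ∧ ‖φ.coeff k‖ ≤ C ^ j) (ω h : ℝ) :
    ∃ R : ℝ, 0 < R ∧ ∃ g : ℂ → ℂ, TendstoUniformlyOn (φ.partialSum ω) g atTop (sector ω h R) := by
  classical
  have hC0 : 0 < C := by linarith
  have hs0 : (0 : ℝ) < s := by exact_mod_cast hs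
  have hs0' : (s : ℂ) ≠ 0 := by exact_mod_cast (by omega : s ≠ 0)
  have hex : ∀ k, ∃ j : ℕ, φ.coeff k ≠ 0 → φ.expo k = j / s ∧ ‖φ.coeff k‖ ≤ C ^ j := fun k => by
    by_cases hk : φ.coeff k = 0
    · exact ⟨0, fun h0 => absurd hk h0⟩
    · obtain ⟨j, hj⟩ := hφ k hk
      exact ⟨j, fun _ => hj⟩
  choose j hj using hex
  set T : Set ℕ := {k | φ.coeff k ≠ 0} with hT
  have hu : Summable (T.indicator fun k => (1 / 2 : ℝ) ^ j k) := by
    rw [← summable_subtype_iff_indicator]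
    refine summable_geometric_two.comp_injective (i := fun k : T => j k) ?_
    intro a b hab
    apply Subtype.ext
    apply φ.expo_injective
    rw [(hj a a.2).1, (hj b b.2).1]
    exact congrArg (fun t : ℕ => (t : ℂ) / s) hab
  refine ⟨(1 / (2 * C)) ^ s, by positivity, _, tendstoUniformlyOn_tsum_nat hu ?_⟩
  rintro k x ⟨hx0, hxR, -⟩
  by_cases hk : φ.coeff k = 0
  · rw [hk, zero_mul, norm_zero]
    exact Set.indicator_nonneg (fun _ _ => by positivity) _
  rw [Set.indicator_of_mem (show k ∈ T from hk), norm_mul, (hj k hk).1]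
  have hlog : (sectorLog ω x).re = Real.log ‖x‖ := by
    have h1 : ‖Complex.exp (-(ω * Complex.I))‖ = 1 := by
      rw [Complex.norm_exp]
      simp
    rw [sectorLog, Complex.add_re, Complex.log_re, norm_mul, h1, mul_one]
    simp
  have hxpos : 0 < ‖x‖ := norm_pos_iff.2 hx0
  have hroot : Real.exp (Real.log ‖x‖ / s) ≤ 1 / (2 * C) := by
    rw [← Real.le_log_iff_exp_le (by positivity), div_le_iff₀ hs0, mul_comm, ← Real.log_pow]
    exact Real.log_le_log hxpos hxR.le
  have hexp : ‖Complex.exp ((j k : ℂ) / s * sectorLog ω x)‖ ≤ (1 / (2 * C)) ^ j k := by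
    have h1 : ((j k : ℂ) / s * sectorLog ω x).re = j k * (Real.log ‖x‖ / s) := by
      rw [← Complex.ofReal_natCast, ← Complex.ofReal_natCast, ← Complex.ofReal_div,
        Complex.re_ofReal_mul, hlog]
      ring
    rw [Complex.norm_exp, h1, Real.exp_nat_mul]
    gcongr
  calc ‖φ.coeff k‖ * ‖Complex.exp ((j k : ℂ) / s * sectorLog ω x)‖
      ≤ C ^ j k * (1 / (2 * C)) ^ j k :=
        mul_le_mul (hj k hk).2 hexp (norm_nonneg _) (by positivity)
    _ = (1 / 2) ^ j k := by
        rw [← mul_pow]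
        congr 1
        field_simp

end GenPowerSeries

/-! ### Nonresonance and conclusion. -/

/-- A Diophantine condition at all roots excludes that exponentials of the semigroup are roots. -/
theorem eval_exp_ne_zero_of_lt_norm {τ : ℕ} {ρ : Fin τ → ℂ} {l : ℂ} {P : Polynomial ℂ}
    (h : ∀ a : ℂ, P.IsRoot a → ∃ c γ : ℝ, 0 < c ∧ ∀ m : Fin τ → ℕ, m ≠ 0 → ∀ k : ℤ,
      c * (∑ i, (m i : ℝ)) ^ (-γ) <
        ‖(∑ i, (m i : ℂ) * ρ i) * l - Complex.log a - 2 * Real.pi * k * Complex.I‖)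
    {m : Fin τ → ℕ} (hm : m ≠ 0) :
    P.eval (Complex.exp ((∑ i, (m i : ℂ) * ρ i) * l)) ≠ 0 := by
  intro h0
  obtain ⟨c, γ, hc, hlt⟩ := h _ h0
  obtain ⟨k, hk⟩ := Complex.log_exp_exists ((∑ i, (m i : ℂ) * ρ i) * l)
  have h1 := hlt m hm (-k)
  have h2 : (0 : ℝ) ≤ c * (∑ i, (m i : ℝ)) ^ (-γ) :=
    mul_nonneg hc.le (Real.rpow_nonneg (Finset.sum_nonneg fun i _ => Nat.cast_nonneg _) _)
  rw [hk] at h1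
  refine absurd (h2.trans_lt h1) (not_lt.2 (le_of_eq ?_))
  rw [norm_eq_zero]
  push_cast
  ring

theorem mainTheorem1
    (n : ℕ) (q lnq : ℂ) (hq1 : q ≠ 1) (hlnq : Complex.exp lnq = q)
    -- the equation: `F` is holomorphic near `0 ∈ ℂⁿ⁺²`, with Taylor series `f`;
    -- the variables are `x` (index `0`) and `y_j` (index `j + 1`)
    (F : (Fin (n + 2) → ℂ) → ℂ) (f : MvPowerSeries (Fin (n + 2)) ℂ)
    (hF : HasTaylorSeriesAtZero F f)
    -- the formal solution
    (φ : GenPowerSeries) (hsol : φ.IsFormalSolution lnq f)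
    -- the partial derivatives `∂F/∂y_j` along `φ`
    (ν : ℂ) (A : Fin (n + 1) → ℂ)
    (hA : ∀ j : Fin (n + 1),
      HasForm (φ.substCoeff lnq (MvPowerSeries.pderiv ℂ j.succ f)) (A j) ν)
    -- the semigroup generated by `ρ₁, …, ρ_τ` contains all exponents of `φ`
    (τ : ℕ) (ρ : Fin τ → ℂ) (hρ_re : ∀ i, 0 < (ρ i).re) (hρ_indep : LinearIndependent ℤ ρ)
    (hΓ : ∀ k, φ.coeff k ≠ 0 → ∃ m : Fin τ → ℕ, m ≠ 0 ∧ φ.expo k = ∑ i, (m i : ℂ) * ρ i)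
    -- the hypotheses on `L`
    (hAn : A (Fin.last n) ≠ 0) (hA0 : A 0 ≠ 0)
    (hdioph : ∀ a : ℂ, ((Polynomial.X - 1) * charPolynomial A).IsRoot a →
      ∃ c γ : ℝ, 0 < c ∧ 0 < γ ∧ ∀ m : Fin τ → ℕ, m ≠ 0 → ∀ k : ℤ,
        c * (∑ i, (m i : ℝ)) ^ (-γ) <
          ‖(∑ i, (m i : ℂ) * ρ i) * lnq - Complex.log a - 2 * Real.pi * k * Complex.I‖) :
    -- uniform convergence in sectors of opening `2 h < 2 π`
    ∀ ω h : ℝ, 0 < h → h < Real.pi → ∃ R : ℝ, 0 < R ∧ ∃ s : ℂ → ℂ,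
      TendstoUniformlyOn (φ.partialSum ω) s atTop (sector ω h R) := by
  intro ω h _ _
  have hroot : ∀ a : ℂ, (charPolynomial A).IsRoot a → ∃ c γ : ℝ, 0 < c ∧
      ∀ m : Fin τ → ℕ, m ≠ 0 → ∀ k : ℤ, c * (∑ i, (m i : ℝ)) ^ (-γ) <
        ‖(∑ i, (m i : ℂ) * ρ i) * lnq - Complex.log a - 2 * Real.pi * k * Complex.I‖ := by
    intro a ha
    obtain ⟨c, γ, hc, -, hlt⟩ := hdioph a (Polynomial.root_mul_left_of_isRoot _ ha)
    exact ⟨c, γ, hc, hlt⟩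
  have hL : ∀ m : Fin τ → ℕ, m ≠ 0 →
      (charPolynomial A).eval (Complex.exp ((∑ i, (m i : ℂ) * ρ i) * lnq)) ≠ 0 :=
    fun m hm => eval_exp_ne_zero_of_lt_norm hroot hm
  have hrat := φ.exists_rat_expo hsol hA fun k hk => by
    obtain ⟨m, hm, hexp⟩ := hΓ k hk
    rw [hexp]
    exact hL m hm
  obtain ⟨s, hs, hφ⟩ : ∃ s : ℕ, 1 ≤ s ∧ ∀ k, φ.coeff k ≠ 0 → ∃ j : ℕ, φ.expo k = j / s := by
    obtain ⟨s, hs, hT⟩ := exists_common_denominator hρ_re hρ_indep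
      (T := φ.expo '' {k | φ.coeff k ≠ 0})
      (by rintro _ ⟨k, hk, rfl⟩; exact hrat k hk) (by rintro _ ⟨k, hk, rfl⟩; exact hΓ k hk)
    exact ⟨s, hs, fun k hk => hT _ ⟨k, hk, rfl⟩⟩
  have hs0 : (0 : ℝ) < s := by exact_mod_cast hs
  have hs0' : (s : ℂ) ≠ 0 := by exact_mod_cast (by omega : s ≠ 0)
  set S := ramifiedSemigroup ρ s with hSdef
  have hSψ : ∀ j ∉ S, PowerSeries.coeff j (φ.toRamified s) = 0 := by
    intro j hjS
    by_contra hne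
    rw [GenPowerSeries.toRamified, PowerSeries.coeff_mk] at hne
    obtain ⟨k, hk, hk0⟩ :=
      GenPowerSeries.exists_of_coeff_toHahn_sigma_iterate_ne_zero (lnq := lnq) (φ := φ) (j := 0) hne
    obtain ⟨m, hm, hexp⟩ := hΓ k hk0
    exact hjS ⟨m, hm, (toExp_injective hk).trans hexp⟩
  have hS1 : ∀ j ∈ S, 1 ≤ j := fun j hj => pos_of_mem_ramifiedSemigroup hρ_re hj
  have hdioph' : ∀ a : ℂ, ((Polynomial.X - 1) * charPolynomial A).IsRoot a →
      LogDiophantine S (lnq / s) a := by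
    intro a ha
    obtain ⟨c, γ, hc, -, hlt⟩ := hdioph a ha
    exact logDiophantine_ramifiedSemigroup hρ_re hs hc hlt
  have hQ : ∀ j : ℕ, Complex.exp (lnq / s) ^ j = Complex.exp (j * (lnq / s)) :=
    fun j => (Complex.exp_nat_mul _ _).symm
  obtain ⟨D, hD, hDS⟩ := SiegelBounded.charPolynomial hAn hA0
    (fun i hi j hj hij => sub_mem_ramifiedSemigroup hρ_re hρ_indep hs hi hj hij)
    (fun a ha => hdioph' a (Polynomial.root_mul_left_of_isRoot _ ha))
    (hdioph' 1 (Polynomial.root_mul_right_of_isRoot _ (by simp)))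
  obtain ⟨K, B, hK, hB, hf⟩ := hF.exists_norm_coeff_le
  -- The coefficient at `x^ν` of the derivative in `y_n` is `A_n ≠ 0`, so `ν` must occur among the
  -- exponents `j / s`.
  obtain ⟨ν', rfl⟩ := GenPowerSeries.exists_eq_div_of_substCoeff_ne_zero hs hφ
    (h := by rw [(hA (Fin.last n)).1]; exact hAn)
  obtain ⟨C, hC, hbound⟩ := exists_norm_coeff_le_pow (ν := ν') (A := A) hs
    (hSψ 0 fun h0 => absurd (hS1 0 h0) (by omega)) hf hK hB
    (fun k => by rw [← GenPowerSeries.substCoeff_eq_finsum hs hφ]; exact hsol _)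
    (fun i k hk => by
      rw [← GenPowerSeries.substCoeff_eq_finsum hs hφ]
      split_ifs with hkν
      · rw [hkν]
        exact (hA i).1
      · refine (hA i).2 _ (fun heq => hkν ?_) ?_
        · rw [div_left_inj' hs0'] at heq
          exact_mod_cast heq
        · simp only [← Complex.ofReal_natCast, ← Complex.ofReal_div, Complex.ofReal_re]
          gcongr)
    hSψ hD (fun j hj => by rw [hQ]; exact hDS j hj)
    (fun j hj _ => by
      obtain ⟨m, hm, hmj⟩ := hj
      have h1 := hL m hm
      rw [← hmj] at h1
      rw [hQ]
      convert h1 using 3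
      ring)
  refine GenPowerSeries.exists_tendstoUniformlyOn_partialSum hs hC (fun k hk => ?_) ω h
  obtain ⟨j, hj⟩ := hφ k hk
  refine ⟨j, hj, ?_⟩
  have h1 := hbound j
  rwa [GenPowerSeries.toRamified, PowerSeries.coeff_mk, ← hj, GenPowerSeries.coeff_toHahn] at h1
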